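/- **Setting.** Let $\mathcal R_p$ be the set of proper real rational transfer matrices in $z$ (of the size required by context), and let $\mathcal{RH}_2=\mathcal{RH}_\infty$ be the set of those with no pole in $|z|\ge 1$. For $G=\sum_{i\ge 0}z^{-i}G_i\in\mathcal R_p$ write $\|G\|^2=\sum_{i\ge0}\operatorname{Tr}(G_iG_i^T)\in[0,\infty]$ (the squared $\mathcal H_2$ norm, equal to $\infty$ if $G\notin\mathcal H_2$). Consider the discrete-time plant with real matrices $$G_{11}=C_1(zI-A)^{-1}B_1,\quad G_{12}=C_1(zI-A)^{-1}B_2+D_{12},\quad G_{21}=C_2(zI-A)^{-1}B_1+D_{21},\quad G_{22}=C_2(zI-A)^{-1}B_2,$$ where $p_2$ is the number of columns of $B_2$ and $q_2$ the number of rows of $C_2$. Assume that $(A,B_1)$ and $(A,B_2)$ are stabilizable, $(A,C_1)$ and $(A,C_2)$ are detectable, $D_{12}^TC_1=0$, $D_{12}^TD_{12}=I$, $D_{21}B_1^T=0$, $D_{21}D_{21}^T=I$. Let $N\ge1$, let $\mathcal Y_1,\dots,\mathcal Y_N$ be linear subspaces of $\mathbb R^{p_2\times q_2}$ (for instance, given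 by sparsity patterns), and put $\mathcal Y=\bigoplus_{i=1}^N z^{-i}\mathcal Y_i$ and $\mathcal S=\mathcal Y\oplus z^{-(N+1)}\mathcal R_p$. Assume that $\mathcal S$ is quadratically invariant under $G_{22}$: $\mathcal K G_{22}\mathcal K\in\mathcal S$ for all $\mathcal K\in\mathcal S$. Let $\mathcal{RX}=\bigoplus_{i=1}^N z^{-i}\mathbb R^{p_2\times q_2}$ and $\mathcal{RX}_p=\bigoplus_{i=0}^N z^{-i}\mathbb R^{p_2\times q_2}$, and let $P_{\mathcal X}$, $P_{\mathcal X_p}$ denote the orthogonal projections in $\mathcal H_2$ onto $\bigoplus_{i=1}^N z^{-i}\mathbb C^{p_2\times q_2}$ and $\bigoplus_{i=0}^N z^{-i}\mathbb C^{p_2\times q_2}$. The decentralized $\mathcal H_2$ problem is to minimize $\|G_{11}+G_{12}\mathcal K(I-G_{22}\mathcal K)^{-1}G_{21}\|^2$ over $\mathcal K\in\mathcal S$. Let $X$ and $Y$ be the stabilizing (symmetric) solutions of $$X=C_1^TC_1+A^TXA-A^TXB_2(I+B_2^TXB_2)^{-1}B_2^TXA,\qquad Y=B_1B_1^T+AYA^T-AYC_2^T(I+C_2YC_2^T)^{-1}C_2YA^T,$$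 and put $\Omega=I+B_2^TXB_2$, $\Psi=I+C_2YC_2^T$, $K=-\Omega^{-1}B_2^TXA$, $L=-AYC_2^T\Psi^{-1}$; "stabilizing" means that $\Omega$ and $\Psi$ are invertible and all eigenvalues of $A+B_2K$ and $A+LC_2$ lie in the open unit disc. Define $$\begin{bmatrix}\hat M&\hat Y\\ \hat N&\hat X\end{bmatrix}=\begin{bmatrix}K\\ C_2\end{bmatrix}(zI-A-B_2K)^{-1}\begin{bmatrix}B_2&-L\end{bmatrix}+I,\qquad \begin{bmatrix}\tilde X&-\tilde Y\\-\tilde N&\tilde M\end{bmatrix}=\begin{bmatrix}-K\\-C_2\end{bmatrix}(zI-A-LC_2)^{-1}\begin{bmatrix}B_2&-L\end{bmatrix}+I,$$ and $P_{11}=G_{11}+G_{12}\hat Y\tilde MG_{21}$, $P_{12}=-G_{12}\hat M$, $P_{21}=\tilde MG_{21}$. **Theorem.** The eight transfer matrices above form a doubly-coprime factorization of $G_{22}$ (all are stable, $G_{22}=\hat N\hat M^{-1}=\tilde M^{-1}\tilde N$, and the product of the second block matrix with the first is $I$). The quadratic program $$\min_{V\in\mathcal{RX}}\ \|\Omega^{1/2}V\Psi^{1/2}\|^2\quad\text{subject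 to}\quad P_{\mathcal X}\big((\hat Y-\hat MV)\tilde M\big)\in\mathcal Y$$ has a unique optimal solution $V^*$. The matrix $\hat X-\hat NV^*$ is invertible, and $$\mathcal K^*=(\hat Y-\hat MV^*)(\hat X-\hat NV^*)^{-1}$$ belongs to $\mathcal S$, internally stabilizes the plant, and is the unique optimal solution of the decentralized $\mathcal H_2$ problem. The optimal cost is finite and equals $\|P_{11}\|^2+\|\Omega^{1/2}V^*\Psi^{1/2}\|^2$. Moreover the delayed Youla term is optimally zero: $(U,V)=(0,V^*)$ is the unique minimizer of $\|P_{11}+P_{12}(U+V)P_{21}\|^2$ over $U\in z^{-(N+1)}\mathcal{RH}_2$ and $V\in\mathcal{RX}_p$ subject to $P_{\mathcal X_p}\big((\hat Y-\hat MV)\tilde M\big)\in\mathcal Y$; and for every fixed $V\in\mathcal{RX}$, $U=0$ is the unique minimizer of this cost over $U\in z^{-(N+1)}\mathcal{RH}_2$. -/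

import Mathlib

open scoped Matrix MatrixOrder ENNReal

noncomputable section

namespace DecH2

/-! ### Real rational transfer matrices in the variable `z` -/

/-- Real rational transfer matrices; the indeterminate `RatFunc.X` is the variable `z`. -/
abbrev TF (a b : ℕ) := Matrix (Fin a) (Fin b) (RatFunc ℝ)

/-- A real matrix seen as a constant transfer matrix. -/
def const {a b : ℕ} (M : Matrix (Fin a) (Fin b) ℝ) : TF a b :=
  M.map (RatFunc.C (K := ℝ))

/-- The transfer matrix `C (z I - A)⁻¹ B + D` of a state-space realization. -/
def ss {n a b : ℕ} (A : Matrix (Fin n) (Fin n) ℝ) (B : Matrix (Fin n) (Fin b) ℝ)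
    (C : Matrix (Fin a) (Fin n) ℝ) (D : Matrix (Fin a) (Fin b) ℝ) : TF a b :=
  const C * ((RatFunc.X : RatFunc ℝ) • (1 : TF n n) - const A)⁻¹ * const B + const D

/-- The delay `z⁻ⁱ`. -/
def delay (i : ℕ) : RatFunc ℝ := (RatFunc.X⁻¹) ^ i

/-- Proper transfer matrices: no entry has a pole at infinity. -/
def IsProper {a b : ℕ} (G : TF a b) : Prop :=
  ∀ i j, (G i j).intDegree ≤ 0

/-- Stable transfer matrices, i.e. the real rational members of `H∞` (equivalently of `H²`):
proper, and no entry has a pole `z` with `1 ≤ |z|`. -/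
def IsStable {a b : ℕ} (G : TF a b) : Prop :=
  IsProper G ∧ ∀ i j, ∀ z : ℂ, 1 ≤ ‖z‖ → Polynomial.aeval z (G i j).denom ≠ 0

/-- The expansion of a rational function at infinity: the Laurent series in `w` obtained by
substituting `z = w⁻¹`. -/
def expansion (g : RatFunc ℝ) : LaurentSeries ℝ :=
  RatFunc.eval (HahnSeries.C : ℝ →+* LaurentSeries ℝ) (HahnSeries.single (-1 : ℤ) (1 : ℝ)) g

/-- The `i`-th coefficient `G_i` in the expansion `G(z) = ∑ z⁻ⁱ G_i` of a proper `G`. -/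
def markov {a b : ℕ} (G : TF a b) (i : ℕ) : Matrix (Fin a) (Fin b) ℝ :=
  Matrix.of fun k l => (expansion (G k l)).coeff (i : ℤ)

/-- The squared `H²` norm `∑ Tr(G_i G_iᵀ)` of a proper real rational transfer matrix,
with value `∞` if `G` is not in `H²`. -/
def h2NormSq {a b : ℕ} (G : TF a b) : ℝ≥0∞ :=
  ∑' i : ℕ, ENNReal.ofReal (Matrix.trace (markov G i * (markov G i)ᵀ))

/-! ### Finite impulse response spaces and the information constraint -/

/-- The FIR transfer matrix `∑_{i ∈ s} z⁻ⁱ F_i`. -/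
def fir {a b : ℕ} (s : Finset ℕ) (F : ℕ → Matrix (Fin a) (Fin b) ℝ) : TF a b :=
  ∑ i ∈ s, delay i • const (F i)

/-- The real FIR transfer matrices `⨁_{i ∈ s} z⁻ⁱ ℝ^{a × b}`. -/
def firSpace (a b : ℕ) (s : Finset ℕ) : Set (TF a b) :=
  {V | ∃ F : ℕ → Matrix (Fin a) (Fin b) ℝ, V = fir s F}

/-- The orthogonal projection, in `H²`, onto `⨁_{i ∈ s} z⁻ⁱ ℂ^{a × b}`. As distinct powers of
`z` are orthogonal, it keeps exactly the coefficients with index in `s`. -/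
def proj {a b : ℕ} (s : Finset ℕ) (G : TF a b) : TF a b :=
  fir s (markov G)

/-- `⨁_{i=1}^{N} z⁻ⁱ 𝒴_i`. -/
def firPattern {a b : ℕ} (N : ℕ) (Yc : ℕ → Submodule ℝ (Matrix (Fin a) (Fin b) ℝ)) :
    Set (TF a b) :=
  {V | ∃ F : ℕ → Matrix (Fin a) (Fin b) ℝ,
    (∀ i ∈ Finset.Icc 1 N, F i ∈ Yc i) ∧ V = fir (Finset.Icc 1 N) F}

/-- The strongly connected delay pattern
`𝒮 = (⨁_{i=1}^{N} z⁻ⁱ 𝒴_i) ⊕ z^{-(N+1)} R_p`, with `R_p` the proper transfer matrices. -/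
def infoSpace {a b : ℕ} (N : ℕ) (Yc : ℕ → Submodule ℝ (Matrix (Fin a) (Fin b) ℝ)) :
    Set (TF a b) :=
  {K | ∃ F ∈ firPattern N Yc, ∃ R : TF a b, IsProper R ∧ K = F + delay (N + 1) • R}

/-- `z^{-k} RH²` (equivalently `z^{-k} RH∞`). -/
def delayedStable (a b k : ℕ) : Set (TF a b) :=
  {U | ∃ R : TF a b, IsStable R ∧ U = delay k • R}

/-- Quadratic invariance of a set of controllers with respect to `H`. -/
def QuadInvariant {a b : ℕ} (S : Set (TF a b)) (H : TF b a) : Prop :=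
  ∀ K ∈ S, K * H * K ∈ S

/-! ### Stability, stabilizability and detectability of real matrices -/

/-- All eigenvalues lie in the open unit disc. -/
def IsSchur {n : ℕ} (A : Matrix (Fin n) (Fin n) ℝ) : Prop :=
  ∀ z ∈ spectrum ℂ (A.map (algebraMap ℝ ℂ)), ‖z‖ < 1

def Stabilizable {n m : ℕ} (A : Matrix (Fin n) (Fin n) ℝ) (B : Matrix (Fin n) (Fin m) ℝ) :
    Prop :=
  ∃ F : Matrix (Fin m) (Fin n) ℝ, IsSchur (A + B * F)

def Detectable {n m : ℕ} (A : Matrix (Fin n) (Fin n) ℝ) (C : Matrix (Fin m) (Fin n) ℝ) :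
    Prop :=
  ∃ F : Matrix (Fin n) (Fin m) ℝ, IsSchur (A + F * C)

/-! ### The plant -/

/-- State-space data of the plant, with `D₁₁ = 0` and `D₂₂ = 0`. -/
structure Plant (n p1 p2 q1 q2 : ℕ) where
  A : Matrix (Fin n) (Fin n) ℝ
  B1 : Matrix (Fin n) (Fin p1) ℝ
  B2 : Matrix (Fin n) (Fin p2) ℝ
  C1 : Matrix (Fin q1) (Fin n) ℝ
  C2 : Matrix (Fin q2) (Fin n) ℝ
  D12 : Matrix (Fin q1) (Fin p2) ℝ
  D21 : Matrix (Fin q2) (Fin p1) ℝ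

/-- `x` is an optimal solution, and the only one, of: minimize `f` over `s`. -/
def IsUniqueMinimizer {α : Type*} (f : α → ℝ≥0∞) (s : Set α) (x : α) : Prop :=
  x ∈ s ∧ IsMinOn f s x ∧ ∀ y ∈ s, IsMinOn f s y → y = x

/-- The given stable transfer matrices form a doubly-coprime factorization of `H`. -/
structure IsDoublyCoprime {a b : ℕ} (H : TF b a)
    (Mh : TF a a) (Nh : TF b a) (Xh : TF b b) (Yh : TF a b)
    (Mt : TF b b) (Nt : TF b a) (Xt : TF a a) (Yt : TF a b) : Prop where
  stable_Mh : IsStable Mh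
  stable_Nh : IsStable Nh
  stable_Xh : IsStable Xh
  stable_Yh : IsStable Yh
  stable_Mt : IsStable Mt
  stable_Nt : IsStable Nt
  stable_Xt : IsStable Xt
  stable_Yt : IsStable Yt
  isUnit_Mh : IsUnit Mh
  isUnit_Mt : IsUnit Mt
  right_fact : H = Nh * Mh⁻¹
  left_fact : H = Mt⁻¹ * Nt
  bezout : Matrix.fromBlocks Xt (-Yt) (-Nt) Mt * Matrix.fromBlocks Mh Yh Nh Xh = 1

namespace Plant

variable {n p1 p2 q1 q2 : ℕ} (P : Plant n p1 p2 q1 q2)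

def G11 : TF q1 p1 := ss P.A P.B1 P.C1 0
def G12 : TF q1 p2 := ss P.A P.B2 P.C1 P.D12
def G21 : TF q2 p1 := ss P.A P.B1 P.C2 P.D21
def G22 : TF q2 p2 := ss P.A P.B2 P.C2 0

/-- The standing assumptions on the plant. -/
structure Regular : Prop where
  stabilizable_B1 : Stabilizable P.A P.B1
  detectable_C1 : Detectable P.A P.C1
  stabilizable_B2 : Stabilizable P.A P.B2
  detectable_C2 : Detectable P.A P.C2
  D12_C1 : P.D12ᵀ * P.C1 = 0
  D12_D12 : P.D12ᵀ * P.D12 = 1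
  D21_B1 : P.D21 * P.B1ᵀ = 0
  D21_D21 : P.D21 * P.D21ᵀ = 1

/-- The closed-loop transfer matrix `G₁₁ + G₁₂ 𝒦 (I - G₂₂ 𝒦)⁻¹ G₂₁`. -/
def closedLoop (Kc : TF p2 q2) : TF q1 p1 :=
  P.G11 + P.G12 * Kc * (1 - P.G22 * Kc)⁻¹ * P.G21

/-- The `H²` cost of a controller. -/
def cost (Kc : TF p2 q2) : ℝ≥0∞ := h2NormSq (P.closedLoop Kc)

/-- Internal stability: the loop `z = G₁₁ w + G₁₂ u`, `y = G₂₁ w + G₂₂ u + v₂`, `u = 𝒦 y + v₁`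
is well posed, and all nine maps from `(w, v₁, v₂)` to `(z, u, y)` are stable. -/
structure InternallyStabilizes (Kc : TF p2 q2) : Prop where
  well_posed_y : IsUnit (1 - P.G22 * Kc)
  well_posed_u : IsUnit (1 - Kc * P.G22)
  w_to_z : IsStable (P.closedLoop Kc)
  w_to_u : IsStable ((1 - Kc * P.G22)⁻¹ * Kc * P.G21)
  w_to_y : IsStable ((1 - P.G22 * Kc)⁻¹ * P.G21)
  v1_to_z : IsStable (P.G12 * (1 - Kc * P.G22)⁻¹)
  v1_to_u : IsStable ((1 - Kc * P.G22)⁻¹)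
  v1_to_y : IsStable ((1 - P.G22 * Kc)⁻¹ * P.G22)
  v2_to_z : IsStable (P.G12 * (1 - Kc * P.G22)⁻¹ * Kc)
  v2_to_u : IsStable ((1 - Kc * P.G22)⁻¹ * Kc)
  v2_to_y : IsStable ((1 - P.G22 * Kc)⁻¹)

/-! ### Riccati equations and gains -/

/-- `Ω = I + B₂ᵀ X B₂`. -/
def Om (X : Matrix (Fin n) (Fin n) ℝ) : Matrix (Fin p2) (Fin p2) ℝ :=
  1 + P.B2ᵀ * X * P.B2

/-- `Ψ = I + C₂ Y C₂ᵀ`. -/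
def Psi (Y : Matrix (Fin n) (Fin n) ℝ) : Matrix (Fin q2) (Fin q2) ℝ :=
  1 + P.C2 * Y * P.C2ᵀ

/-- The regulator gain `K = -Ω⁻¹ B₂ᵀ X A`. -/
def gainK (X : Matrix (Fin n) (Fin n) ℝ) : Matrix (Fin p2) (Fin n) ℝ :=
  -((P.Om X)⁻¹ * P.B2ᵀ * X * P.A)

/-- The filter gain `L = -A Y C₂ᵀ Ψ⁻¹`. -/
def gainL (Y : Matrix (Fin n) (Fin n) ℝ) : Matrix (Fin n) (Fin q2) ℝ :=
  -(P.A * Y * P.C2ᵀ * (P.Psi Y)⁻¹)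

/-- `X` is a stabilizing solution of the regulator Riccati equation. -/
structure IsStabilizingX (X : Matrix (Fin n) (Fin n) ℝ) : Prop where
  symm : X.IsSymm
  isUnit : IsUnit (P.Om X)
  riccati : X = P.C1ᵀ * P.C1 + P.Aᵀ * X * P.A
    - P.Aᵀ * X * P.B2 * (1 + P.B2ᵀ * X * P.B2)⁻¹ * P.B2ᵀ * X * P.A
  schur : IsSchur (P.A + P.B2 * P.gainK X)

/-- `Y` is a stabilizing solution of the filter Riccati equation. -/
structure IsStabilizingY (Y : Matrix (Fin n) (Fin n) ℝ) : Prop where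
  symm : Y.IsSymm
  isUnit : IsUnit (P.Psi Y)
  riccati : Y = P.B1 * P.B1ᵀ + P.A * Y * P.Aᵀ
    - P.A * Y * P.C2ᵀ * (1 + P.C2 * Y * P.C2ᵀ)⁻¹ * P.C2 * Y * P.Aᵀ
  schur : IsSchur (P.A + P.gainL Y * P.C2)

/-! ### The doubly-coprime factorization from the two gains -/

section Factors

variable (K : Matrix (Fin p2) (Fin n) ℝ) (L : Matrix (Fin n) (Fin q2) ℝ)

def Mhat : TF p2 p2 := ss (P.A + P.B2 * K) P.B2 K 1
def Yhat : TF p2 q2 := ss (P.A + P.B2 * K) (-L) K 0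
def Nhat : TF q2 p2 := ss (P.A + P.B2 * K) P.B2 P.C2 0
def Xhat : TF q2 q2 := ss (P.A + P.B2 * K) (-L) P.C2 1
def Xtil : TF p2 p2 := ss (P.A + L * P.C2) P.B2 (-K) 1
def Ytil : TF p2 q2 := -ss (P.A + L * P.C2) (-L) (-K) 0
def Ntil : TF q2 p2 := -ss (P.A + L * P.C2) P.B2 (-P.C2) 0
def Mtil : TF q2 q2 := ss (P.A + L * P.C2) (-L) (-P.C2) 1

/-- `P₁₁ = G₁₁ + G₁₂ Ŷ M̃ G₂₁`. -/
def P11 : TF q1 p1 := P.G11 + P.G12 * P.Yhat K L * P.Mtil L * P.G21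

/-- `P₁₂ = -G₁₂ M̂`. -/
def P12 : TF q1 p2 := -(P.G12 * P.Mhat K)

/-- `P₂₁ = M̃ G₂₁`. -/
def P21 : TF q2 p1 := P.Mtil L * P.G21

/-- The controller `(Ŷ - M̂ Q)(X̂ - N̂ Q)⁻¹` with Youla parameter `Q`. -/
def youla (Q : TF p2 q2) : TF p2 q2 :=
  (P.Yhat K L - P.Mhat K * Q) * (P.Xhat K L - P.Nhat K * Q)⁻¹

/-- Feasible set of the quadratic program: real strictly proper FIR matrices `V` with
`P_𝒳((Ŷ - M̂ V) M̃) ∈ 𝒴`. -/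
def qpFeasible (N : ℕ) (Yc : ℕ → Submodule ℝ (Matrix (Fin p2) (Fin q2) ℝ)) : Set (TF p2 q2) :=
  {V | V ∈ firSpace p2 q2 (Finset.Icc 1 N) ∧
    proj (Finset.Icc 1 N) ((P.Yhat K L - P.Mhat K * V) * P.Mtil L) ∈ firPattern N Yc}

/-- Feasible set of the model matching problem: pairs `(U, V)` with `U ∈ z^{-(N+1)} RH²`,
`V` a real proper FIR matrix, and `P_{𝒳_p}((Ŷ - M̂ V) M̃) ∈ 𝒴`. -/
def mmFeasible (N : ℕ) (Yc : ℕ → Submodule ℝ (Matrix (Fin p2) (Fin q2) ℝ)) :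
    Set (TF p2 q2 × TF p2 q2) :=
  {UV | UV.1 ∈ delayedStable p2 q2 (N + 1) ∧ UV.2 ∈ firSpace p2 q2 (Finset.Icc 0 N) ∧
    proj (Finset.Icc 0 N) ((P.Yhat K L - P.Mhat K * UV.2) * P.Mtil L) ∈ firPattern N Yc}

/-- The model matching cost `‖P₁₁ + P₁₂ (U + V) P₂₁‖²`. -/
def mmCost (U V : TF p2 q2) : ℝ≥0∞ :=
  h2NormSq (P.P11 K L + P.P12 K * (U + V) * P.P21 L)

end Factors

/-- The cost `‖Ω^{1/2} V Ψ^{1/2}‖²` of the quadratic program, with positive semidefinite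
square roots. -/
def qpCost (X Y : Matrix (Fin n) (Fin n) ℝ) (V : TF p2 q2) : ℝ≥0∞ :=
  h2NormSq (const (CFC.sqrt (P.Om X)) * V * const (CFC.sqrt (P.Psi Y)))

end Plant

end DecH2

end

noncomputable section

namespace DecH2

/-! ### The expansion at infinity -/

/-! The Youla parametrization turns the problem into an orthogonal projection. Every strictly proper
controller is `youla Q` for a strictly proper `Q`. In terms of `Q` the closed loop is the affine
expression `P11 + P12 Q P21` (`closedLoop_youla`), and `𝒦 (I - G₂₂ 𝒦)⁻¹` is the affine `loopTerm`,
`(Ŷ - M̂ Q) M̃`.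

Cost. The Riccati equations say that `G₁₂ M̂` and the transpose of `M̃ G₂₁` are lossless
(`lossless_of_riccati`). Summing the energy balance shows that they are isometries up to the weights
`Ω` and `Ψ`, and that `P11` is orthogonal to `P12 Q P21` for stable strictly proper `Q` (`ip_P11`).
Hence the cost is `‖P11‖² + ‖Ω^{1/2} Q Ψ^{1/2}‖²` (`h2NormSq_P11_add`). Constant weights act
coefficient by coefficient, so the first `N` coefficients `V` of `Q` and its tail `U` contribute
separately.

Constraint. Under quadratic invariance a controller lies in `𝒮` exactly when its loop term does
(`youla_mem_infoSpace_iff`). As `M̂` and `M̃` are proper, this restricts `V` only. So `U = 0` is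
optimal, and `V` solves a definite quadratic program on a nonempty finite-dimensional affine space;
its solution satisfies a Pythagorean identity (`exists_qp_solution`), which gives uniqueness.

Controllers in `𝒮` need not be stabilizing a priori. A rational matrix of finite `H²` norm is stable
(`isStable_of_h2NormSq_ne_top`), and stability of `P12 Q P21` forces that of `Q`
(`isStable_of_P12_mul_P21`), so finite cost brings every competitor into the stable case. Orders of
vanishing at infinity (`VanishesTo`) and Markov parameters carry the algebra. -/

theorem coeff_single_neg_one_mul (f : LaurentSeries ℝ) (i : ℤ) :
    (HahnSeries.single (-1 : ℤ) (1 : ℝ) * f).coeff i = f.coeff (i + 1) := by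
  rw [HahnSeries.coeff_single_mul]; simp

/-- The expansion at infinity of a polynomial. -/
def polyExpansion : Polynomial ℝ →+* LaurentSeries ℝ :=
  Polynomial.eval₂RingHom HahnSeries.C (HahnSeries.single (-1 : ℤ) (1 : ℝ))

theorem coeff_polyExpansion_monomial (n : ℕ) (r : ℝ) (i : ℤ) :
    (polyExpansion (Polynomial.monomial n r)).coeff i = if i = -n then r else 0 := by
  induction n generalizing i with
  | zero => simp [polyExpansion, HahnSeries.C_apply, HahnSeries.coeff_single]
  | succ n ih =>
    rw [← Polynomial.monomial_mul_X, map_mul, mul_comm]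
    have : polyExpansion Polynomial.X = HahnSeries.single (-1 : ℤ) (1 : ℝ) := by
      simp [polyExpansion]
    rw [this, coeff_single_neg_one_mul, ih]
    congr 1
    push_cast
    exact propext ⟨fun h => by linarith, fun h => by linarith⟩

theorem coeff_polyExpansion (p : Polynomial ℝ) (n : ℕ) :
    (polyExpansion p).coeff (-n : ℤ) = p.coeff n := by
  induction p using Polynomial.induction_on' with
  | add p q hp hq => simp [hp, hq]
  | monomial m r =>
    rw [coeff_polyExpansion_monomial, Polynomial.coeff_monomial]
    simp [eq_comm]

theorem coeff_polyExpansion_pos (p : Polynomial ℝ) {i : ℤ} (hi : 0 < i) :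
    (polyExpansion p).coeff i = 0 := by
  induction p using Polynomial.induction_on' with
  | add p q hp hq => simp [hp, hq]
  | monomial m r =>
    rw [coeff_polyExpansion_monomial, if_neg (by omega)]

theorem coeff_polyExpansion_of_lt (p : Polynomial ℝ) {i : ℤ} (hi : i < -p.natDegree) :
    (polyExpansion p).coeff i = 0 := by
  obtain ⟨n, rfl⟩ : ∃ n : ℕ, i = -n := ⟨i.natAbs, by omega⟩
  rw [coeff_polyExpansion]
  exact Polynomial.coeff_eq_zero_of_natDegree_lt (by omega)

theorem polyExpansion_ne_zero {p : Polynomial ℝ} (hp : p ≠ 0) : polyExpansion p ≠ 0 := by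
  intro h
  have := coeff_polyExpansion p p.natDegree
  rw [h] at this
  exact hp (Polynomial.leadingCoeff_eq_zero.mp this.symm)

theorem order_polyExpansion {p : Polynomial ℝ} (hp : p ≠ 0) :
    (polyExpansion p).order = -(p.natDegree : ℤ) := by
  apply le_antisymm
  · apply HahnSeries.order_le_of_coeff_ne_zero
    rw [coeff_polyExpansion]
    exact fun h => hp (Polynomial.leadingCoeff_eq_zero.mp h)
  · by_contra! h
    have := coeff_polyExpansion_of_lt p h
    rw [HahnSeries.coeff_order_eq_zero] at this
    exact polyExpansion_ne_zero hp this

theorem expansion_def (g : RatFunc ℝ) :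
    expansion g = polyExpansion g.num / polyExpansion g.denom := rfl

theorem expansion_mul_denom (g : RatFunc ℝ) :
    polyExpansion g.denom * expansion g = polyExpansion g.num := by
  rw [expansion_def, mul_div_cancel₀]
  exact polyExpansion_ne_zero g.denom_ne_zero

theorem expansion_add (g h : RatFunc ℝ) : expansion (g + h) = expansion g + expansion h :=
  RatFunc.eval_add _ _ (polyExpansion_ne_zero g.denom_ne_zero)
    (polyExpansion_ne_zero h.denom_ne_zero)

theorem expansion_mul (g h : RatFunc ℝ) : expansion (g * h) = expansion g * expansion h :=
  RatFunc.eval_mul _ _ (polyExpansion_ne_zero g.denom_ne_zero)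
    (polyExpansion_ne_zero h.denom_ne_zero)

/-- The expansion at infinity as a ring homomorphism. -/
def expansionHom : RatFunc ℝ →+* LaurentSeries ℝ where
  toFun := expansion
  map_one' := RatFunc.eval_one _ _
  map_zero' := RatFunc.eval_zero _ _
  map_add' := expansion_add
  map_mul' := expansion_mul

theorem expansionHom_apply (g : RatFunc ℝ) : expansionHom g = expansion g := rfl

theorem expansion_C (r : ℝ) : expansion (RatFunc.C r) = HahnSeries.C r :=
  RatFunc.eval_C _ _

theorem expansion_X : expansion RatFunc.X = HahnSeries.single (-1 : ℤ) (1 : ℝ) :=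
  RatFunc.eval_X _ _

theorem expansion_ne_zero {g : RatFunc ℝ} (hg : g ≠ 0) : expansion g ≠ 0 := by
  rw [← expansionHom_apply]; simpa using hg

theorem order_expansion {g : RatFunc ℝ} (hg : g ≠ 0) : (expansion g).order = -g.intDegree := by
  have h := congrArg HahnSeries.order (expansion_mul_denom g)
  rw [HahnSeries.order_mul (polyExpansion_ne_zero g.denom_ne_zero) (expansion_ne_zero hg),
    order_polyExpansion g.denom_ne_zero, order_polyExpansion (RatFunc.num_ne_zero hg)] at h
  rw [RatFunc.intDegree]
  linarith

/-- `g` is a multiple of `z⁻ᵏ` by a proper rational function. -/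
def DegLE (k : ℤ) (g : RatFunc ℝ) : Prop := g = 0 ∨ g.intDegree ≤ -k

/-- The order of the expansion is minus the degree. Products are easy on the degree side, sums and
truncations on the coefficient side; this is the bridge. -/
theorem degLE_iff_coeff {k : ℤ} {g : RatFunc ℝ} :
    DegLE k g ↔ ∀ i < k, (expansion g).coeff i = 0 := by
  constructor
  · rintro (rfl | h) i hi
    · rw [← expansionHom_apply]; simp
    · by_cases hg : g = 0
      · rw [hg, ← expansionHom_apply]; simp
      apply HahnSeries.coeff_eq_zero_of_lt_order
      rw [order_expansion hg]; omega
  · intro h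
    by_cases hg : g = 0
    · exact Or.inl hg
    · right
      by_contra! hk
      have := h (expansion g).order (by rw [order_expansion hg]; omega)
      rw [HahnSeries.coeff_order_eq_zero] at this
      exact expansion_ne_zero hg this

theorem DegLE.add {k : ℤ} {g h : RatFunc ℝ} (hg : DegLE k g) (hh : DegLE k h) :
    DegLE k (g + h) := by
  rw [degLE_iff_coeff] at *
  intro i hi
  rw [expansion_add, HahnSeries.coeff_add, hg i hi, hh i hi, add_zero]

theorem DegLE.mul {k l : ℤ} {g h : RatFunc ℝ} (hg : DegLE k g) (hh : DegLE l h) :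
    DegLE (k + l) (g * h) := by
  by_cases h1 : g = 0
  · left; simp [h1]
  by_cases h2 : h = 0
  · left; simp [h2]
  right
  rw [RatFunc.intDegree_mul h1 h2]
  have := hg.resolve_left h1
  have := hh.resolve_left h2
  omega

theorem DegLE.mono {k l : ℤ} {g : RatFunc ℝ} (hg : DegLE k g) (h : l ≤ k) : DegLE l g :=
  hg.imp id fun h' => by omega

theorem degLE_zero_iff {g : RatFunc ℝ} : DegLE 0 g ↔ g.intDegree ≤ 0 := by
  constructor
  · rintro (rfl | h)
    · simp
    · simpa using h
  · intro h; right; simpa using h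

theorem degLE_zero (k : ℤ) : DegLE k 0 := Or.inl rfl

theorem degLE_C (r : ℝ) : DegLE 0 (RatFunc.C r) := Or.inr (by simp)

theorem intDegree_delay (k : ℕ) : (delay k).intDegree = -k := by
  induction k with
  | zero => simp [delay]
  | succ k ih =>
    rw [delay] at *
    rw [pow_succ, RatFunc.intDegree_mul (pow_ne_zero _ (inv_ne_zero RatFunc.X_ne_zero))
      (inv_ne_zero RatFunc.X_ne_zero), ih, RatFunc.intDegree_inv, RatFunc.intDegree_X]
    push_cast; ring

theorem degLE_delay (k : ℕ) : DegLE k (delay k) := Or.inr (intDegree_delay k).le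

theorem expansion_delay (k : ℕ) : expansion (delay k) = HahnSeries.single (k : ℤ) (1 : ℝ) := by
  rw [← expansionHom_apply, delay, map_pow, map_inv₀, expansionHom_apply, expansion_X,
    HahnSeries.inv_single]
  simp

/-! ### Stability of scalar rational functions and decay of the coefficients -/

/-- No pole at infinity or in `1 ≤ |z|`. -/
def ScalarStable (g : RatFunc ℝ) : Prop :=
  g.intDegree ≤ 0 ∧ ∀ z : ℂ, 1 ≤ ‖z‖ → Polynomial.aeval z g.denom ≠ 0

theorem aeval_ne_zero_of_dvd {p q : Polynomial ℝ} (h : p ∣ q) {z : ℂ}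
    (hq : Polynomial.aeval z q ≠ 0) : Polynomial.aeval z p ≠ 0 := by
  obtain ⟨r, rfl⟩ := h
  rw [map_mul] at hq
  exact left_ne_zero_of_mul hq

theorem ScalarStable.add {g h : RatFunc ℝ} (hg : ScalarStable g) (hh : ScalarStable h) :
    ScalarStable (g + h) := by
  refine ⟨degLE_zero_iff.mp ((degLE_zero_iff.mpr hg.1).add (degLE_zero_iff.mpr hh.1)),
    fun z hz => aeval_ne_zero_of_dvd (RatFunc.denom_add_dvd g h) ?_⟩
  rw [map_mul]
  exact mul_ne_zero (hg.2 z hz) (hh.2 z hz)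

theorem ScalarStable.mul {g h : RatFunc ℝ} (hg : ScalarStable g) (hh : ScalarStable h) :
    ScalarStable (g * h) := by
  refine ⟨degLE_zero_iff.mp ((degLE_zero_iff.mpr hg.1).mul (degLE_zero_iff.mpr hh.1)),
    fun z hz => aeval_ne_zero_of_dvd (RatFunc.denom_mul_dvd g h) ?_⟩
  rw [map_mul]
  exact mul_ne_zero (hg.2 z hz) (hh.2 z hz)

theorem scalarStable_C (r : ℝ) : ScalarStable (RatFunc.C r) := by
  refine ⟨by simp, fun z _ => by simp⟩

theorem scalarStable_delay (k : ℕ) : ScalarStable (delay k) := by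
  refine ⟨by rw [intDegree_delay]; omega, fun z hz => ?_⟩
  have h : (delay k).denom ∣ Polynomial.X ^ k := by
    have := RatFunc.denom_div_dvd (1 : Polynomial ℝ) (Polynomial.X ^ k)
    rwa [map_one, map_pow, RatFunc.algebraMap_X, one_div, ← inv_pow] at this
  refine aeval_ne_zero_of_dvd h ?_
  rw [map_pow, Polynomial.aeval_X]
  refine pow_ne_zero _ fun h0 => ?_
  rw [h0, norm_zero] at hz
  linarith

/-- The ring of stable rational functions. -/
def stableRing : Subring (RatFunc ℝ) where
  carrier := {g | ScalarStable g}
  mul_mem' := ScalarStable.mul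
  one_mem' := by simpa using scalarStable_C 1
  add_mem' := ScalarStable.add
  zero_mem' := by simpa using scalarStable_C 0
  neg_mem' := fun {g} hg => by
    have := (scalarStable_C (-1)).mul hg
    simpa using this

/-- Multiplying back by the polynomial `zᵏ` creates no finite pole; the hypothesis on `g` excludes
the pole at infinity. -/
theorem ScalarStable.of_delay_mul {g : RatFunc ℝ} {k : ℕ} (hg : ScalarStable (delay k * g))
    (hk : DegLE 0 g) : ScalarStable g := by
  refine ⟨degLE_zero_iff.mp hk, fun z hz => ?_⟩
  have h1 : g = (RatFunc.X) ^ k * (delay k * g) := by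
    rw [delay, ← mul_assoc, ← mul_pow, mul_inv_cancel₀ RatFunc.X_ne_zero, one_pow, one_mul]
  have h2 := RatFunc.denom_mul_dvd ((RatFunc.X : RatFunc ℝ) ^ k) (delay k * g)
  rw [← h1] at h2
  have h3 : ((RatFunc.X : RatFunc ℝ) ^ k).denom = 1 := by
    rw [← RatFunc.algebraMap_X, ← map_pow, RatFunc.denom_algebraMap]
  rw [h3, one_mul] at h2
  exact aeval_ne_zero_of_dvd h2 (hg.2 z hz)

/-- The left shift of two-sided sequences. -/
def shift : Module.End ℂ (ℤ → ℂ) where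
  toFun f i := f (i + 1)
  map_add' _ _ := rfl
  map_smul' _ _ := rfl

theorem shift_apply (f : ℤ → ℂ) (i : ℤ) : shift f i = f (i + 1) := rfl

/-- Transfers to `p(shift) f` any property of sequences closed under linear combinations and
shifting; used for decay at `+∞` and for vanishing near `-∞`. -/
theorem aeval_shift_induction {W : (ℤ → ℂ) → Prop} (hadd : ∀ f g, W f → W g → W (f + g))
    (hsmul : ∀ (c : ℂ) f, W f → W (c • f)) (hshift : ∀ f, W f → W (shift f))
    (p : Polynomial ℂ) (f : ℤ → ℂ) (hf : W f) : W (Polynomial.aeval shift p f) := by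
  induction p using Polynomial.induction_on' with
  | add p q hp hq => rw [map_add]; exact hadd _ _ hp hq
  | monomial n a =>
    rw [Polynomial.aeval_monomial]
    change W (a • ((shift ^ n) f))
    apply hsmul
    induction n with
    | zero => simpa using hf
    | succ n ih => rw [pow_succ']; exact hshift _ ih

/-- Multiplication by `z` is the left shift on coefficients, so multiplication by a polynomial is
that polynomial in the shift. -/
theorem aeval_shift_coeff (q : Polynomial ℝ) (h : LaurentSeries ℝ) (i : ℤ) :
    Polynomial.aeval shift (q.map (algebraMap ℝ ℂ)) (fun i => (h.coeff i : ℂ)) i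
      = ((polyExpansion q * h).coeff i : ℂ) := by
  induction q using Polynomial.induction_on' generalizing i with
  | add p q hp hq =>
    rw [Polynomial.map_add, map_add, LinearMap.add_apply, Pi.add_apply, hp, hq, map_add, add_mul,
      HahnSeries.coeff_add]
    push_cast; rfl
  | monomial n a =>
    induction n generalizing i with
    | zero =>
      have : polyExpansion (Polynomial.monomial 0 a) = HahnSeries.C a := by
        simp [polyExpansion]
      rw [this, HahnSeries.C_mul_eq_smul, Polynomial.map_monomial, Polynomial.aeval_monomial]
      simp
    | succ n ih =>
      rw [← Polynomial.monomial_mul_X, mul_comm, map_mul, Polynomial.map_mul, map_mul,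
        Polynomial.map_X, Polynomial.aeval_X, Module.End.mul_apply, shift_apply, ih]
      have : polyExpansion Polynomial.X = HahnSeries.single (-1 : ℤ) (1 : ℝ) := by
        simp [polyExpansion]
      rw [this, mul_assoc, coeff_single_neg_one_mul]

/-- The complexified coefficients of a rational function at infinity. -/
def cCoeff (g : RatFunc ℝ) (i : ℤ) : ℂ := ((expansion g).coeff i : ℂ)

/-- The coefficients obey a linear recurrence whose characteristic polynomial is the denominator;
the forcing comes from the numerator and stops after index 0. -/
theorem aeval_shift_denom (g : RatFunc ℝ) (i : ℤ) :
    Polynomial.aeval shift (g.denom.map (algebraMap ℝ ℂ)) (cCoeff g) i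
      = ((polyExpansion g.num).coeff i : ℂ) := by
  rw [← expansion_mul_denom]; exact aeval_shift_coeff _ _ i

/-- Absolute summability at `+∞`. -/
def SummableTail (f : ℤ → ℂ) : Prop := Summable fun i : ℕ => ‖f i‖

/-- Summing `‖f (i+1)‖ ≤ ‖f (i+1) - a f i‖ + ‖a‖ ‖f i‖` bounds `(1 - ‖a‖)` times each partial sum by
`‖f 0‖` plus the given total. -/
theorem SummableTail.of_shift_sub {a : ℂ} (ha : ‖a‖ < 1) {f : ℤ → ℂ}
    (h : SummableTail (fun i => f (i + 1) - a * f i)) : SummableTail f := by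
  refine summable_of_sum_range_le (c := (‖f 0‖ + ∑' i : ℕ, ‖f (i + 1) - a * f i‖) / (1 - ‖a‖))
    (fun _ => norm_nonneg _) fun n => ?_
  rw [le_div_iff₀ (by linarith)]
  have h1 : ∑ i ∈ Finset.range n, ‖f ((i : ℕ) + 1)‖ ≤
      ∑ i ∈ Finset.range n, (‖f ((i : ℕ) + 1) - a * f i‖ + ‖a‖ * ‖f i‖) := by
    refine Finset.sum_le_sum fun i _ => ?_
    rw [← norm_mul]
    calc _ = ‖(f ((i : ℕ) + 1) - a * f i) + a * f i‖ := by rw [sub_add_cancel]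
      _ ≤ _ := norm_add_le _ _
  rw [Finset.sum_add_distrib, ← Finset.mul_sum] at h1
  have h2 : ∑ i ∈ Finset.range n, ‖f ((i : ℕ) + 1) - a * f i‖ ≤ ∑' i : ℕ, ‖f (i + 1) - a * f i‖ :=
    h.sum_le_tsum _ fun _ _ => norm_nonneg _
  have h3 := Finset.sum_range_succ (fun i : ℕ => ‖f i‖) n
  rw [Finset.sum_range_succ'] at h3
  push_cast at h3
  have := norm_nonneg (f (n : ℤ))
  nlinarith

theorem SummableTail.of_aeval_shift {f : ℤ → ℂ} (s : Multiset ℂ) (hs : ∀ a ∈ s, ‖a‖ < 1)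
    (h : SummableTail
      (Polynomial.aeval shift (s.map fun a => Polynomial.X - Polynomial.C a).prod f)) :
    SummableTail f := by
  induction s using Multiset.induction_on with
  | empty => simpa using h
  | cons a s ih =>
    rw [Multiset.map_cons, Multiset.prod_cons, map_mul] at h
    refine ih (fun b hb => hs b (Multiset.mem_cons_of_mem hb)) ?_
    refine SummableTail.of_shift_sub (hs a (Multiset.mem_cons_self a s)) ?_
    convert h using 1
    ext i
    simp [shift_apply]

/-- Over `ℂ` the denominator splits into factors with roots in the open disc. Applied to the
coefficients it gives a sequence with no positive-index terms, and the factors are then removed one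
by one. -/
theorem ScalarStable.summable_coeff {g : RatFunc ℝ} (hg : ScalarStable g) :
    Summable fun i : ℕ => ‖(expansion g).coeff (i : ℤ)‖ := by
  have key : SummableTail (cCoeff g) := by
    set q := g.denom.map (algebraMap ℝ ℂ) with hq
    have hmonic : q.Monic := g.monic_denom.map _
    have hsplit := (IsAlgClosed.splits q).eq_prod_roots_of_monic hmonic
    refine SummableTail.of_aeval_shift q.roots (fun a ha => ?_) ?_
    · by_contra! hn
      refine hg.2 a hn ?_
      have := (Polynomial.mem_roots'.mp ha).2
      rwa [hq, Polynomial.IsRoot, Polynomial.eval_map_algebraMap] at this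
    · rw [← hsplit]
      refine summable_of_hasFiniteSupport ((Set.finite_singleton 0).subset fun i hi => ?_)
      by_contra hne
      apply hi
      have : (0 : ℤ) < i := by have : i ≠ 0 := hne; omega
      simp only [hq, aeval_shift_denom, coeff_polyExpansion_pos _ this]
      simp
  simpa [SummableTail, cCoeff] using key

/-- Suppose the denominator has a root `a` with `1 ≤ ‖a‖`, and let `d` be the coefficients filtered
by the remaining factor. Forward, `d` is geometric of ratio `a`, so decay forces `d 1 = 0`.
Backward, the recurrence from `d 1 = 0` then evaluates the numerator at `a` to zero, against
coprimality. -/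
theorem scalarStable_of_tendsto {g : RatFunc ℝ} (hg : g.intDegree ≤ 0)
    (h : Filter.Tendsto (fun i : ℕ => (expansion g).coeff (i : ℤ)) Filter.atTop (nhds 0)) :
    ScalarStable g := by
  refine ⟨hg, fun a ha h0 => ?_⟩
  set q := g.denom.map (algebraMap ℝ ℂ) with hq
  have hroot : q.IsRoot a := by rwa [hq, Polynomial.IsRoot, Polynomial.eval_map_algebraMap]
  obtain ⟨r, hr⟩ := Polynomial.dvd_iff_isRoot.mpr hroot
  set d := Polynomial.aeval shift r (cCoeff g) with hd
  have hlim : Filter.Tendsto (fun i : ℕ => d i) Filter.atTop (nhds 0) := by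
    refine aeval_shift_induction (W := fun f => Filter.Tendsto (fun i : ℕ => f i) Filter.atTop
      (nhds 0)) ?_ ?_ ?_ r (cCoeff g) ?_
    · intro f g hf hg; simpa using hf.add hg
    · intro c f hf; simpa using hf.const_mul c
    · intro f hf
      have := hf.comp (Filter.tendsto_add_atTop_nat 1)
      simpa [Function.comp_def, shift_apply] using this
    · simpa [cCoeff, Function.comp_def] using (Complex.continuous_ofReal.tendsto 0).comp h
  obtain ⟨m, hm⟩ : ∃ m : ℤ, ∀ i < m, d i = 0 := by
    refine aeval_shift_induction (W := fun f => ∃ m : ℤ, ∀ i < m, f i = 0) ?_ ?_ ?_ r (cCoeff g) ?_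
    · rintro f g ⟨m, hm⟩ ⟨m', hm'⟩
      refine ⟨min m m', fun i hi => ?_⟩
      simp [hm i (lt_of_lt_of_le hi (min_le_left _ _)),
        hm' i (lt_of_lt_of_le hi (min_le_right _ _))]
    · rintro c f ⟨m, hm⟩
      exact ⟨m, fun i hi => by simp [hm i hi]⟩
    · rintro f ⟨m, hm⟩
      exact ⟨m - 1, fun i hi => hm _ (by omega)⟩
    · refine ⟨0, fun i hi => ?_⟩
      rw [cCoeff, degLE_iff_coeff.mp (degLE_zero_iff.mpr hg) i hi, Complex.ofReal_zero]
  have hrec : ∀ i, d (i + 1) - a * d i = ((polyExpansion g.num).coeff i : ℂ) := by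
    intro i
    rw [← aeval_shift_denom, ← hq, hr, map_mul, Module.End.mul_apply, ← hd]
    simp [shift_apply]
  have hpow : ∀ i : ℕ, d (i + 1) = a ^ i * d 1 := by
    intro i
    induction i with
    | zero => simp
    | succ i ih =>
      have := hrec (i + 1)
      rw [coeff_polyExpansion_pos _ (by omega), Complex.ofReal_zero, sub_eq_zero] at this
      push_cast
      rw [this, ih]; ring
  have hd1 : d 1 = 0 := by
    have h1 := (hlim.comp (Filter.tendsto_add_atTop_nat 1)).norm
    simp only [Function.comp_def, Nat.cast_add, Nat.cast_one, norm_zero] at h1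
    have h2 : ‖d 1‖ ≤ 0 := by
      refine ge_of_tendsto' h1 fun i => ?_
      rw [hpow, norm_mul, norm_pow]
      exact le_mul_of_one_le_left (norm_nonneg _) (one_le_pow₀ ha)
    exact norm_le_zero_iff.mp h2
  -- The recurrence is run backwards from `d 1 = 0`, accumulating the numerator coefficients as a
  -- partial evaluation at `a`.
  have htel : ∀ n : ℕ, ∑ k ∈ Finset.range n, (g.num.coeff k : ℂ) * a ^ k
      = - (a ^ n * d (1 - n)) := by
    intro n
    induction n with
    | zero => simp [hd1]
    | succ n ih =>
      rw [Finset.sum_range_succ, ih, ← coeff_polyExpansion, ← hrec]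
      have e1 : (-n + 1 : ℤ) = 1 - n := by ring
      have e2 : (1 - (n + 1 : ℕ) : ℤ) = -n := by push_cast; ring
      rw [e1, e2]; ring
  have hnum : Polynomial.aeval a g.num = 0 := by
    -- The cut-off is large enough to include every numerator coefficient and to push `1 - n` below
    -- `m`, where `d` vanishes.
    have h1 := htel (max (g.num.natDegree + 1) (1 - m + 1).toNat)
    rw [hm _ (by omega), mul_zero, neg_zero] at h1
    rw [Polynomial.aeval_eq_sum_range' (lt_of_lt_of_le (Nat.lt_succ_self _)
      (le_max_left _ (1 - m + 1).toNat)), ← h1]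
    refine Finset.sum_congr rfl fun k _ => ?_
    rw [Algebra.smul_def]; rfl
  obtain ⟨u, v, huv⟩ := g.isCoprime_num_denom
  have := congrArg (Polynomial.aeval a) huv
  rw [map_add, map_mul, map_mul, hnum, h0] at this
  simp at this

variable {a b c : ℕ}

/-! ### Constant transfer matrices -/

theorem const_mul (M : Matrix (Fin a) (Fin b) ℝ) (M' : Matrix (Fin b) (Fin c) ℝ) :
    const (M * M') = const M * const M' := Matrix.map_mul

theorem const_add (M M' : Matrix (Fin a) (Fin b) ℝ) : const (M + M') = const M + const M' :=
  Matrix.map_add _ (map_add _) _ _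

theorem const_neg (M : Matrix (Fin a) (Fin b) ℝ) : const (-M) = -const M := by
  ext i j : 2; simp [const]

theorem const_zero : const (0 : Matrix (Fin a) (Fin b) ℝ) = 0 :=
  Matrix.map_zero _ (map_zero _)

theorem const_one : const (1 : Matrix (Fin a) (Fin a) ℝ) = 1 :=
  Matrix.map_one _ (map_zero _) (map_one _)

theorem const_transpose (M : Matrix (Fin a) (Fin b) ℝ) : const Mᵀ = (const M)ᵀ := rfl

/-! ### Filtration by the order of vanishing at infinity -/

/-- `G` is `z⁻ᵏ` times a proper transfer matrix. -/
def VanishesTo (k : ℤ) (G : TF a b) : Prop := ∀ i j, DegLE k (G i j)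

theorem vanishesTo_zero_iff {G : TF a b} : VanishesTo 0 G ↔ IsProper G :=
  forall_congr' fun _ => forall_congr' fun _ => degLE_zero_iff

theorem DegLE.sum {k : ℤ} {ι : Type*} (s : Finset ι) {f : ι → RatFunc ℝ}
    (h : ∀ i ∈ s, DegLE k (f i)) : DegLE k (∑ i ∈ s, f i) :=
  Finset.sum_induction f (DegLE k) (fun _ _ => DegLE.add) (degLE_zero k) h

theorem VanishesTo.add {k : ℤ} {G H : TF a b} (hG : VanishesTo k G) (hH : VanishesTo k H) :
    VanishesTo k (G + H) := fun i j => (hG i j).add (hH i j)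

theorem VanishesTo.mul {k l : ℤ} {G : TF a b} {H : TF b c} (hG : VanishesTo k G)
    (hH : VanishesTo l H) : VanishesTo (k + l) (G * H) := fun i j => by
  rw [Matrix.mul_apply]
  exact DegLE.sum _ fun m _ => (hG i m).mul (hH m j)

theorem VanishesTo.mono {k l : ℤ} {G : TF a b} (hG : VanishesTo k G) (h : l ≤ k) :
    VanishesTo l G := fun i j => (hG i j).mono h

theorem VanishesTo.smul {k l : ℤ} {g : RatFunc ℝ} {G : TF a b} (hg : DegLE k g)
    (hG : VanishesTo l G) : VanishesTo (k + l) (g • G) := fun i j => hg.mul (hG i j)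

theorem vanishesTo_const (M : Matrix (Fin a) (Fin b) ℝ) : VanishesTo 0 (const M) :=
  fun _ _ => degLE_C _

theorem vanishesTo_one : VanishesTo 0 (1 : TF a a) := const_one (a := a) ▸ vanishesTo_const _

theorem vanishesTo_zero (k : ℤ) : VanishesTo k (0 : TF a b) := fun _ _ => degLE_zero k

theorem VanishesTo.neg {k : ℤ} {G : TF a b} (hG : VanishesTo k G) : VanishesTo k (-G) := by
  have := (vanishesTo_const (-1 : Matrix (Fin a) (Fin a) ℝ)).mul hG
  simpa [const_neg, const_one] using this

theorem VanishesTo.sub {k : ℤ} {G H : TF a b} (hG : VanishesTo k G) (hH : VanishesTo k H) :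
    VanishesTo k (G - H) := sub_eq_add_neg G H ▸ hG.add hH.neg

theorem VanishesTo.transpose {k : ℤ} {G : TF a b} (hG : VanishesTo k G) : VanishesTo k Gᵀ :=
  fun i j => hG j i

theorem VanishesTo.mul_proper {k : ℤ} {G : TF a b} {H : TF b c} (hG : VanishesTo k G)
    (hH : VanishesTo 0 H) : VanishesTo k (G * H) := by simpa using hG.mul hH

theorem VanishesTo.proper_mul {k : ℤ} {G : TF a b} {H : TF b c} (hG : VanishesTo 0 G)
    (hH : VanishesTo k H) : VanishesTo k (G * H) := by simpa using hG.mul hH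

theorem exists_vanishesTo (G : TF a b) : ∃ k : ℤ, VanishesTo k G := by
  refine ⟨-∑ i, ∑ j, ((G i j).intDegree.natAbs : ℤ), fun i j => Or.inr ?_⟩
  rw [neg_neg]
  calc (G i j).intDegree ≤ ((G i j).intDegree.natAbs : ℤ) := by omega
    _ ≤ ∑ j, ((G i j).intDegree.natAbs : ℤ) :=
      Finset.single_le_sum (f := fun j => ((G i j).intDegree.natAbs : ℤ))
        (fun _ _ => by positivity) (Finset.mem_univ j)
    _ ≤ _ := Finset.single_le_sum (f := fun i => ∑ j, ((G i j).intDegree.natAbs : ℤ))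
        (fun _ _ => by positivity) (Finset.mem_univ i)

/-- Bootstrapping: a solution of `J = F - E J` with `E` strictly proper inherits the order of
vanishing of `F`. -/
theorem vanishesTo_of_eq_sub {k : ℤ} {E : TF a a} {F J : TF a b} (hE : VanishesTo 1 E)
    (hF : VanishesTo k F) (h : J = F - E * J) : VanishesTo k J := by
  obtain ⟨m, hm⟩ := exists_vanishesTo J
  -- Each substitution into the equation gains one order, up to the ceiling `k`.
  have key : ∀ n : ℕ, VanishesTo (min k (m + n)) J := by
    intro n
    induction n with
    | zero => exact hm.mono (by simp)
    | succ n ih =>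
      rw [h]
      refine (hF.mono (min_le_left _ _)).sub ((hE.mul ih).mono ?_)
      push_cast; omega
  exact (key (k - m).toNat).mono (by omega)

/-- A kernel vector satisfies `v = -E v`, so by bootstrapping it vanishes to every order and is
zero. -/
theorem isUnit_one_add {E : TF a a} (hE : VanishesTo 1 E) : IsUnit (1 + E) := by
  rw [Matrix.isUnit_iff_isUnit_det, isUnit_iff_ne_zero]
  intro h0
  obtain ⟨v, hv, hv0⟩ := Matrix.exists_mulVec_eq_zero_iff.mpr h0
  rw [Matrix.add_mulVec, Matrix.one_mulVec] at hv0
  set J : TF a 1 := Matrix.of fun i _ => v i with hJ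
  have hJE : J = 0 - E * J := by
    rw [zero_sub, eq_neg_iff_add_eq_zero]
    ext i j : 2
    exact congrFun hv0 i
  apply hv
  ext i : 1
  by_contra hne
  -- The order asked for is one more than the exact order of `v i`.
  rcases vanishesTo_of_eq_sub (k := 1 - (v i).intDegree) hE (vanishesTo_zero _) hJE i 0 with h | h
  · exact hne h
  · change (v i).intDegree ≤ _ at h
    omega

theorem inv_vanishesTo {E : TF a a} (hE : VanishesTo 1 E) : VanishesTo 0 (1 + E)⁻¹ := by
  refine vanishesTo_of_eq_sub hE vanishesTo_one ?_
  have h := Matrix.mul_nonsing_inv (1 + E) ((Matrix.isUnit_iff_isUnit_det _).mp (isUnit_one_add hE))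
  rw [add_mul, one_mul] at h
  exact eq_sub_of_add_eq h

/-! ### Markov parameters -/

theorem markov_apply (G : TF a b) (t : ℕ) (i : Fin a) (j : Fin b) :
    markov G t i j = (expansion (G i j)).coeff (t : ℤ) := rfl

theorem expansion_zero : expansion 0 = 0 := map_zero expansionHom

theorem expansion_sum {ι : Type*} (s : Finset ι) (f : ι → RatFunc ℝ) :
    expansion (∑ i ∈ s, f i) = ∑ i ∈ s, expansion (f i) := map_sum expansionHom f s

theorem markov_add (G H : TF a b) (t : ℕ) : markov (G + H) t = markov G t + markov H t := by
  ext i j; simp [markov_apply, expansion_add]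

theorem markov_zero (t : ℕ) : markov (0 : TF a b) t = 0 := by
  ext i j; simp [markov_apply, expansion_zero]

theorem markov_neg (G : TF a b) (t : ℕ) : markov (-G) t = -markov G t := by
  rw [eq_neg_iff_add_eq_zero, ← markov_add, neg_add_cancel, markov_zero]

theorem markov_sub (G H : TF a b) (t : ℕ) : markov (G - H) t = markov G t - markov H t := by
  rw [sub_eq_add_neg, markov_add, markov_neg, sub_eq_add_neg]

theorem markov_sum {ι : Type*} (s : Finset ι) (f : ι → TF a b) (t : ℕ) :
    markov (∑ i ∈ s, f i) t = ∑ i ∈ s, markov (f i) t := by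
  classical
  induction s using Finset.induction_on with
  | empty => simp [markov_zero]
  | insert i s hi ih => rw [Finset.sum_insert hi, Finset.sum_insert hi, markov_add, ih]

theorem markov_transpose (G : TF a b) (t : ℕ) : markov Gᵀ t = (markov G t)ᵀ := rfl

theorem coeff_expansion_C_mul (r : ℝ) (g : RatFunc ℝ) (t : ℤ) :
    (expansion (RatFunc.C r * g)).coeff t = r * (expansion g).coeff t := by
  rw [expansion_mul, expansion_C, HahnSeries.C_mul_eq_smul]; rfl

theorem markov_const_mul (M : Matrix (Fin a) (Fin b) ℝ) (G : TF b c) (t : ℕ) :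
    markov (const M * G) t = M * markov G t := by
  ext i j
  rw [markov_apply, Matrix.mul_apply, Matrix.mul_apply, expansion_sum, HahnSeries.coeff_sum]
  exact Finset.sum_congr rfl fun k _ => coeff_expansion_C_mul _ _ _

theorem markov_mul_const (G : TF a b) (M : Matrix (Fin b) (Fin c) ℝ) (t : ℕ) :
    markov (G * const M) t = markov G t * M := by
  have := markov_const_mul Mᵀ Gᵀ t
  rw [const_transpose, ← Matrix.transpose_mul, markov_transpose, markov_transpose,
    ← Matrix.transpose_mul] at this
  exact Matrix.transpose_injective this

theorem markov_X_smul (G : TF a b) (t : ℕ) :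
    markov ((RatFunc.X : RatFunc ℝ) • G) t = markov G (t + 1) := by
  ext i j
  rw [markov_apply, Matrix.smul_apply, smul_eq_mul, expansion_mul, expansion_X,
    coeff_single_neg_one_mul]
  rfl

theorem markov_delay_smul_const (k : ℕ) (M : Matrix (Fin a) (Fin b) ℝ) (t : ℕ) :
    markov (delay k • const M) t = if t = k then M else 0 := by
  ext i j
  rw [markov_apply, Matrix.smul_apply, smul_eq_mul, mul_comm]
  change (expansion (RatFunc.C (M i j) * _)).coeff _ = _
  rw [coeff_expansion_C_mul, expansion_delay, HahnSeries.coeff_single]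
  split_ifs <;> simp_all

theorem delay_zero : delay 0 = 1 := pow_zero _

theorem markov_const (M : Matrix (Fin a) (Fin b) ℝ) (t : ℕ) :
    markov (const M) t = if t = 0 then M else 0 := by
  have := markov_delay_smul_const 0 M t
  rwa [delay_zero, one_smul] at this

theorem markov_fir (s : Finset ℕ) (F : ℕ → Matrix (Fin a) (Fin b) ℝ) (t : ℕ) :
    markov (fir s F) t = if t ∈ s then F t else 0 := by
  rw [fir, markov_sum]
  simp only [markov_delay_smul_const]
  rw [Finset.sum_ite_eq]

theorem VanishesTo.markov_eq_zero {k : ℤ} {G : TF a b} (hG : VanishesTo k G) {t : ℕ}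
    (ht : (t : ℤ) < k) : markov G t = 0 := by
  ext i j
  exact degLE_iff_coeff.mp (hG i j) t ht

theorem vanishesTo_of_markov {k : ℕ} {G : TF a b} (hG : VanishesTo 0 G)
    (h : ∀ t < k, markov G t = 0) : VanishesTo k G := by
  intro i j
  rw [degLE_iff_coeff]
  intro t ht
  by_cases h0 : t < 0
  · exact degLE_iff_coeff.mp (hG i j) t h0
  · obtain ⟨t, rfl⟩ := Int.eq_ofNat_of_zero_le (not_lt.mp h0)
    exact congrFun (congrFun (h t (by omega)) i) j

theorem eq_zero_of_markov {G : TF a b} (hG : VanishesTo 0 G) (h : ∀ t, markov G t = 0) :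
    G = 0 := by
  ext i j : 2
  by_contra hne
  have h1 := (vanishesTo_of_markov (k := ((-(G i j).intDegree).toNat + 1)) hG fun t _ => h t) i j
  have h2 := h1.resolve_left hne
  push_cast at h2
  omega

theorem ext_of_markov {G H : TF a b} (hG : VanishesTo 0 G) (hH : VanishesTo 0 H)
    (h : ∀ t, markov G t = markov H t) : G = H :=
  sub_eq_zero.mp (eq_zero_of_markov (hG.sub hH) fun t => by rw [markov_sub, h, sub_self])

theorem markov_zero_mul {G : TF a b} {H : TF b c} (hG : VanishesTo 0 G) (hH : VanishesTo 0 H) :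
    markov (G * H) 0 = markov G 0 * markov H 0 := by
  have h1 : VanishesTo 1 (G - const (markov G 0)) := by
    refine vanishesTo_of_markov (k := 1) (hG.sub (vanishesTo_const _)) fun t ht => ?_
    obtain rfl : t = 0 := by omega
    rw [markov_sub, markov_const, if_pos rfl, sub_self]
  have h2 := (h1.mul_proper hH).markov_eq_zero (t := 0) (by simp)
  rw [Matrix.sub_mul, markov_sub, markov_const_mul, sub_eq_zero] at h2
  exact h2

/-! ### Stable transfer matrices -/

theorem isStable_iff {G : TF a b} : IsStable G ↔ ∀ i j, G i j ∈ stableRing :=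
  ⟨fun h i j => ⟨h.1 i j, h.2 i j⟩, fun h => ⟨fun i j => (h i j).1, fun i j => (h i j).2⟩⟩

theorem IsStable.vanishesTo {G : TF a b} (hG : IsStable G) : VanishesTo 0 G :=
  vanishesTo_zero_iff.mpr hG.1

theorem IsStable.add {G H : TF a b} (hG : IsStable G) (hH : IsStable H) : IsStable (G + H) := by
  rw [isStable_iff] at *
  exact fun i j => stableRing.add_mem (hG i j) (hH i j)

theorem IsStable.neg {G : TF a b} (hG : IsStable G) : IsStable (-G) := by
  rw [isStable_iff] at *
  exact fun i j => stableRing.neg_mem (hG i j)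

theorem IsStable.sub {G H : TF a b} (hG : IsStable G) (hH : IsStable H) : IsStable (G - H) := by
  rw [isStable_iff] at *
  exact fun i j => stableRing.sub_mem (hG i j) (hH i j)

theorem IsStable.mul {G : TF a b} {H : TF b c} (hG : IsStable G) (hH : IsStable H) :
    IsStable (G * H) := by
  rw [isStable_iff] at *
  intro i j
  rw [Matrix.mul_apply]
  exact stableRing.sum_mem fun k _ => stableRing.mul_mem (hG i k) (hH k j)

theorem IsStable.transpose {G : TF a b} (hG : IsStable G) : IsStable Gᵀ := by
  rw [isStable_iff] at *
  exact fun i j => hG j i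

theorem isStable_const (M : Matrix (Fin a) (Fin b) ℝ) : IsStable (const M) :=
  isStable_iff.mpr fun _ _ => scalarStable_C _

theorem isStable_one : IsStable (1 : TF a a) := const_one (a := a) ▸ isStable_const _

theorem isStable_zero : IsStable (0 : TF a b) := const_zero (a := a) (b := b) ▸ isStable_const _

theorem IsStable.delay_smul {G : TF a b} (hG : IsStable G) (k : ℕ) : IsStable (delay k • G) := by
  rw [isStable_iff] at *
  exact fun i j => stableRing.mul_mem (scalarStable_delay k) (hG i j)

theorem IsStable.sum {ι : Type*} (s : Finset ι) {f : ι → TF a b} (h : ∀ i ∈ s, IsStable (f i)) :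
    IsStable (∑ i ∈ s, f i) :=
  Finset.sum_induction f IsStable (fun _ _ => IsStable.add) isStable_zero h

theorem isStable_fir (s : Finset ℕ) (F : ℕ → Matrix (Fin a) (Fin b) ℝ) : IsStable (fir s F) :=
  IsStable.sum _ fun i _ => (isStable_const _).delay_smul i

theorem exists_delay_smul {k : ℕ} {G : TF a b} (hG : VanishesTo k G) :
    ∃ R : TF a b, VanishesTo 0 R ∧ G = delay k • R := by
  refine ⟨(RatFunc.X : RatFunc ℝ) ^ k • G, ?_, ?_⟩
  · have h1 : DegLE (-k) ((RatFunc.X : RatFunc ℝ) ^ k) := by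
      rw [← RatFunc.algebraMap_X, ← map_pow]
      right
      rw [RatFunc.intDegree_polynomial]; simp
    simpa using hG.smul h1
  · rw [smul_smul, delay, ← mul_pow, inv_mul_cancel₀ RatFunc.X_ne_zero, one_pow, one_smul]

theorem mem_delayedStable_iff {k : ℕ} {G : TF a b} :
    G ∈ delayedStable a b k ↔ IsStable G ∧ VanishesTo k G := by
  constructor
  · rintro ⟨R, hR, rfl⟩
    refine ⟨hR.delay_smul k, ?_⟩
    simpa using hR.vanishesTo.smul (degLE_delay k)
  · rintro ⟨h1, h2⟩
    obtain ⟨R, hR, rfl⟩ := exists_delay_smul h2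
    refine ⟨R, isStable_iff.mpr fun i j => ?_, rfl⟩
    exact ScalarStable.of_delay_mul (isStable_iff.mp h1 i j) (hR i j)

/-! ### The information constraint -/

theorem vanishesTo_fir (s : Finset ℕ) (F : ℕ → Matrix (Fin a) (Fin b) ℝ) :
    VanishesTo 0 (fir s F) := (isStable_fir s F).vanishesTo

/-- A general index set `s` covers both projections of the theorem: for `Icc 1 N` the second
condition is void, for `Icc 0 N` it kills the constant coefficient. -/
theorem proj_mem_firPattern_iff {N : ℕ} {s : Finset ℕ} (hs : Finset.Icc 1 N ⊆ s)
    {Yc : ℕ → Submodule ℝ (Matrix (Fin a) (Fin b) ℝ)} {G : TF a b} :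
    proj s G ∈ firPattern N Yc ↔
      (∀ i ∈ Finset.Icc 1 N, markov G i ∈ Yc i) ∧
        ∀ i ∈ s, i ∉ Finset.Icc 1 N → markov G i = 0 := by
  constructor
  · rintro ⟨F, hF, h⟩
    have h' : ∀ i, (if i ∈ s then markov G i else 0) = if i ∈ Finset.Icc 1 N then F i else 0 := by
      intro i
      rw [← markov_fir, ← markov_fir, ← h]; rfl
    refine ⟨fun i hi => ?_, fun i hi hi' => ?_⟩
    · have := h' i
      rw [if_pos (hs hi), if_pos hi] at this
      rw [this]; exact hF i hi
    · have := h' i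
      rwa [if_pos hi, if_neg hi'] at this
  · rintro ⟨h1, h2⟩
    refine ⟨markov G, h1, ?_⟩
    refine ext_of_markov (vanishesTo_fir _ _) (vanishesTo_fir _ _) fun t => ?_
    rw [proj, markov_fir, markov_fir]
    by_cases ht : t ∈ Finset.Icc 1 N
    · rw [if_pos ht, if_pos (hs ht)]
    · rw [if_neg ht]
      split_ifs with h
      · exact h2 t h ht
      · rfl

theorem mem_infoSpace_iff {N : ℕ} {Yc : ℕ → Submodule ℝ (Matrix (Fin a) (Fin b) ℝ)}
    {G : TF a b} :
    G ∈ infoSpace N Yc ↔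
      VanishesTo 1 G ∧ ∀ i ∈ Finset.Icc 1 N, markov G i ∈ Yc i := by
  constructor
  · rintro ⟨_, ⟨F, hF, rfl⟩, R, hR, rfl⟩
    have hR' : VanishesTo ((N + 1 : ℕ) : ℤ) (delay (N + 1) • R) := by
      simpa using (vanishesTo_zero_iff.mpr hR).smul (degLE_delay (N + 1))
    refine ⟨?_, fun i hi => ?_⟩
    · refine VanishesTo.add ?_ (hR'.mono (by push_cast; omega))
      refine vanishesTo_of_markov (k := 1) (vanishesTo_fir _ _) fun t ht => ?_
      rw [markov_fir, if_neg]
      simp only [Finset.mem_Icc]; omega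
    · rw [markov_add, markov_fir, if_pos hi, hR'.markov_eq_zero, add_zero]
      · exact hF i hi
      · rw [Finset.mem_Icc] at hi; push_cast; omega
  · rintro ⟨h1, h2⟩
    have h3 : VanishesTo ((N + 1 : ℕ) : ℤ) (G - fir (Finset.Icc 1 N) (markov G)) := by
      refine vanishesTo_of_markov ((h1.mono (by norm_num)).sub (vanishesTo_fir _ _)) fun t ht => ?_
      rw [markov_sub, markov_fir]
      by_cases h0 : t = 0
      · rw [if_neg (by simp [h0]), h0, h1.markov_eq_zero (by norm_num), sub_zero]
      · rw [if_pos (by rw [Finset.mem_Icc]; omega), sub_self]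
    obtain ⟨R, hR, hR'⟩ := exists_delay_smul h3
    exact ⟨_, ⟨markov G, h2, rfl⟩, R, vanishesTo_zero_iff.mp hR, by rw [← hR']; abel⟩

/-- The information constraint does not see terms of order beyond `N`. -/
theorem mem_infoSpace_congr {N : ℕ} {Yc : ℕ → Submodule ℝ (Matrix (Fin a) (Fin b) ℝ)}
    {G H : TF a b} (h : VanishesTo (N + 1 : ℕ) (G - H)) (hH : H ∈ infoSpace N Yc) :
    G ∈ infoSpace N Yc := by
  rw [mem_infoSpace_iff] at *
  refine ⟨?_, fun i hi => ?_⟩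
  · have := (h.mono (l := 1) (by push_cast; omega)).add hH.1
    simpa using this
  · have := h.markov_eq_zero (t := i) (by rw [Finset.mem_Icc] at hi; push_cast; omega)
    rw [markov_sub, sub_eq_zero] at this
    rw [this]; exact hH.2 i hi

theorem infoSpace_add {N : ℕ} {Yc : ℕ → Submodule ℝ (Matrix (Fin a) (Fin b) ℝ)}
    {G H : TF a b} (hG : G ∈ infoSpace N Yc) (hH : H ∈ infoSpace N Yc) :
    G + H ∈ infoSpace N Yc := by
  rw [mem_infoSpace_iff] at *
  exact ⟨hG.1.add hH.1, fun i hi => markov_add G H i ▸ (Yc i).add_mem (hG.2 i hi) (hH.2 i hi)⟩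

theorem infoSpace_C_smul {N : ℕ} {Yc : ℕ → Submodule ℝ (Matrix (Fin a) (Fin b) ℝ)}
    {G : TF a b} (r : ℝ) (hG : G ∈ infoSpace N Yc) : RatFunc.C r • G ∈ infoSpace N Yc := by
  rw [mem_infoSpace_iff] at *
  refine ⟨by simpa using hG.1.smul (degLE_C r), fun i hi => ?_⟩
  have : markov (RatFunc.C r • G) i = r • markov G i := by
    ext k l; exact coeff_expansion_C_mul _ _ _
  rw [this]
  exact (Yc i).smul_mem r (hG.2 i hi)

theorem zero_mem_infoSpace {N : ℕ} {Yc : ℕ → Submodule ℝ (Matrix (Fin a) (Fin b) ℝ)} :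
    (0 : TF a b) ∈ infoSpace N Yc := by
  rw [mem_infoSpace_iff]
  exact ⟨vanishesTo_zero _, fun i _ => markov_zero (a := a) (b := b) i ▸ (Yc i).zero_mem⟩

theorem infoSpace_neg {N : ℕ} {Yc : ℕ → Submodule ℝ (Matrix (Fin a) (Fin b) ℝ)}
    {G : TF a b} (hG : G ∈ infoSpace N Yc) : -G ∈ infoSpace N Yc := by
  have := infoSpace_C_smul (-1) hG
  simpa using this

/-! ### Quadratic invariance -/

/-- Polarization: with `T = K (H K)ⁱ`, invariance applied to `K + T`, `K` and `T` puts `K H T + T H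
K` in the space, and both summands equal `K (H K)ⁱ⁺¹`. -/
theorem QuadInvariant.mul_mul_pow_mem {N : ℕ} {Yc : ℕ → Submodule ℝ (Matrix (Fin a) (Fin b) ℝ)}
    {H : TF b a} (hQI : QuadInvariant (infoSpace N Yc) H) {K : TF a b} (hK : K ∈ infoSpace N Yc)
    (i : ℕ) : K * (H * K) ^ i ∈ infoSpace N Yc := by
  induction i with
  | zero => simpa using hK
  | succ i ih =>
    set T := K * (H * K) ^ i with hT
    have h1 := hQI _ (infoSpace_add hK ih)
    have h2 := infoSpace_add (infoSpace_add h1 (infoSpace_neg (hQI _ hK)))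
      (infoSpace_neg (hQI _ ih))
    have h3 := infoSpace_C_smul (1 / 2) h2
    have e1 : K * (H * K) ^ (i + 1) = T * H * K := by
      rw [hT, pow_succ]; simp only [Matrix.mul_assoc]
    have e2 : K * (H * K) ^ (i + 1) = K * H * T := by
      rw [hT, pow_succ']; simp only [Matrix.mul_assoc]
    have e3 : (K + T) * H * (K + T) + -(K * H * K) + -(T * H * T) =
        (2 : RatFunc ℝ) • (K * (H * K) ^ (i + 1)) := by
      rw [two_smul]
      nth_rewrite 1 [e1]
      rw [e2]
      simp only [Matrix.add_mul, Matrix.mul_add]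
      abel
    rw [e3, smul_smul] at h3
    have : RatFunc.C (1 / 2 : ℝ) * 2 = 1 := by
      rw [← map_ofNat (RatFunc.C (K := ℝ)) 2, ← map_mul]; norm_num
    rwa [this, one_smul] at h3

/-- Quadratic invariance makes the information space invariant under closing the loop. -/
theorem QuadInvariant.mul_inv_mem {N : ℕ} {Yc : ℕ → Submodule ℝ (Matrix (Fin a) (Fin b) ℝ)}
    {H : TF b a} (hH : VanishesTo 1 H) (hQI : QuadInvariant (infoSpace N Yc) H) {K T : TF a b}
    (hK : K ∈ infoSpace N Yc) (hT : T = K + T * H * K) (hT0 : VanishesTo 0 T) :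
    T ∈ infoSpace N Yc := by
  have hK1 : VanishesTo 0 K := (mem_infoSpace_iff.mp hK).1.mono (by norm_num)
  have hHK : VanishesTo 1 (H * K) := hH.mul_proper hK1
  have hpow : ∀ m : ℕ, VanishesTo m ((H * K) ^ m) := by
    intro m
    induction m with
    | zero => simpa using vanishesTo_one
    | succ m ih =>
      rw [pow_succ]; push_cast; exact ih.mul hHK
  -- A finite Neumann expansion with remainder. For `m = N + 1` the remainder has order beyond `N`,
  -- so no convergence argument is needed.
  have hsum : ∀ m : ℕ, T = ∑ i ∈ Finset.range m, K * (H * K) ^ i + T * (H * K) ^ m := by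
    intro m
    induction m with
    | zero => simp
    | succ m ih =>
      conv_lhs => rw [ih, hT]
      rw [Finset.sum_range_succ, add_assoc, Matrix.add_mul, pow_succ']
      simp only [Matrix.mul_assoc]
  have hmem : ∑ i ∈ Finset.range (N + 1), K * (H * K) ^ i ∈ infoSpace N Yc :=
    Finset.sum_induction _ (· ∈ infoSpace N Yc) (fun _ _ => infoSpace_add) zero_mem_infoSpace
      fun i _ => hQI.mul_mul_pow_mem hK i
  refine mem_infoSpace_congr ?_ hmem
  rw [show T - ∑ i ∈ Finset.range (N + 1), K * (H * K) ^ i = T * (H * K) ^ (N + 1) from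
    sub_eq_of_eq_add' (hsum (N + 1))]
  exact hT0.proper_mul (hpow (N + 1))

theorem QuadInvariant.neg {N : ℕ}
    {Yc : ℕ → Submodule ℝ (Matrix (Fin a) (Fin b) ℝ)} {H : TF b a}
    (hQI : QuadInvariant (infoSpace N Yc) H) : QuadInvariant (infoSpace N Yc) (-H) := by
  intro K hK
  have := infoSpace_neg (hQI K hK)
  simpa using this

/-! ### Resolvents -/

/-- The resolvent `(z I - A)⁻¹`. -/
def res {n : ℕ} (A : Matrix (Fin n) (Fin n) ℝ) : TF n n :=
  ((RatFunc.X : RatFunc ℝ) • (1 : TF n n) - const A)⁻¹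

section Resolvent

variable {n m p q : ℕ} (A : Matrix (Fin n) (Fin n) ℝ)

theorem ss_eq (B : Matrix (Fin n) (Fin m) ℝ) (C : Matrix (Fin p) (Fin n) ℝ)
    (D : Matrix (Fin p) (Fin m) ℝ) :
    ss A B C D = const C * res A * const B + const D := rfl

theorem X_smul_sub_eq : (RatFunc.X : RatFunc ℝ) • (1 : TF n n) - const A =
    (RatFunc.X : RatFunc ℝ) • (1 + -(delay 1 • const A)) := by
  rw [smul_add, smul_neg, smul_smul, delay, pow_one, mul_inv_cancel₀ RatFunc.X_ne_zero, one_smul,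
    sub_eq_add_neg]

theorem vanishesTo_delay_smul_const : VanishesTo 1 (-(delay 1 • const A)) := by
  have := ((vanishesTo_const A).smul (degLE_delay 1)).neg
  simpa using this

theorem isUnit_X_smul_sub : IsUnit ((RatFunc.X : RatFunc ℝ) • (1 : TF n n) - const A) := by
  rw [X_smul_sub_eq]
  have h := isUnit_one_add (vanishesTo_delay_smul_const A)
  exact h.smul (Units.mk0 (RatFunc.X : RatFunc ℝ) RatFunc.X_ne_zero)

theorem res_mul_cancel : res A * ((RatFunc.X : RatFunc ℝ) • (1 : TF n n) - const A) = 1 :=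
  Matrix.nonsing_inv_mul _ ((Matrix.isUnit_iff_isUnit_det _).mp (isUnit_X_smul_sub A))

theorem mul_res_cancel : ((RatFunc.X : RatFunc ℝ) • (1 : TF n n) - const A) * res A = 1 :=
  Matrix.mul_nonsing_inv _ ((Matrix.isUnit_iff_isUnit_det _).mp (isUnit_X_smul_sub A))

variable {A}

/-- The state equation `z x = A x + w` is solved by the resolvent. -/
theorem eq_res_mul_iff {Z W : TF n m} :
    Z = res A * W ↔ (RatFunc.X : RatFunc ℝ) • Z = const A * Z + W := by
  have key : ((RatFunc.X : RatFunc ℝ) • (1 : TF n n) - const A) * Z =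
      (RatFunc.X : RatFunc ℝ) • Z - const A * Z := by
    rw [Matrix.sub_mul, Matrix.smul_mul, Matrix.one_mul]
  rw [← sub_eq_iff_eq_add', ← key]
  constructor
  · rintro rfl
    rw [← Matrix.mul_assoc, mul_res_cancel, Matrix.one_mul]
  · intro h
    rw [← h, ← Matrix.mul_assoc, res_mul_cancel, Matrix.one_mul]

theorem X_smul_res_mul (W : TF n m) :
    (RatFunc.X : RatFunc ℝ) • (res A * W) = const A * (res A * W) + W :=
  eq_res_mul_iff.mp rfl

variable (A)

theorem vanishesTo_res : VanishesTo 1 (res A) := by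
  refine vanishesTo_of_eq_sub (F := delay 1 • 1) (vanishesTo_delay_smul_const A) ?_ ?_
  · simpa using (vanishesTo_one (a := n)).smul (degLE_delay 1)
  · have h := X_smul_res_mul (A := A) (1 : TF n n)
    rw [Matrix.mul_one] at h
    have h2 := congrArg (fun M => delay 1 • M) h
    simp only [smul_smul] at h2
    rw [delay, pow_one, inv_mul_cancel₀ RatFunc.X_ne_zero, one_smul] at h2
    rw [delay, pow_one, Matrix.neg_mul, sub_neg_eq_add, Matrix.smul_mul, ← smul_add, add_comm]
    exact h2

theorem res_transpose : (res A)ᵀ = res Aᵀ := by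
  rw [res, Matrix.transpose_nonsing_inv, Matrix.transpose_sub, Matrix.transpose_smul,
    Matrix.transpose_one, ← const_transpose]
  rfl

theorem ss_transpose (B : Matrix (Fin n) (Fin m) ℝ) (C : Matrix (Fin p) (Fin n) ℝ)
    (D : Matrix (Fin p) (Fin m) ℝ) : (ss A B C D)ᵀ = ss Aᵀ Cᵀ Bᵀ Dᵀ := by
  rw [ss_eq, ss_eq, Matrix.transpose_add, Matrix.transpose_mul, Matrix.transpose_mul,
    res_transpose, const_transpose, const_transpose, const_transpose, Matrix.mul_assoc]

theorem ss_neg_neg (B : Matrix (Fin n) (Fin m) ℝ) (C : Matrix (Fin p) (Fin n) ℝ)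
    (D : Matrix (Fin p) (Fin m) ℝ) : ss A (-B) (-C) D = ss A B C D := by
  simp [ss_eq, const_neg]

theorem vanishesTo_const_res_const (B : Matrix (Fin n) (Fin m) ℝ) (C : Matrix (Fin p) (Fin n) ℝ) :
    VanishesTo 1 (const C * res A * const B) :=
  ((vanishesTo_const C).proper_mul (vanishesTo_res A)).mul_proper (vanishesTo_const B)

theorem vanishesTo_ss (B : Matrix (Fin n) (Fin m) ℝ) (C : Matrix (Fin p) (Fin n) ℝ)
    (D : Matrix (Fin p) (Fin m) ℝ) : VanishesTo 0 (ss A B C D) :=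
  ((vanishesTo_const_res_const A B C).mono (by norm_num)).add (vanishesTo_const D)

theorem vanishesTo_ss_zero (B : Matrix (Fin n) (Fin m) ℝ) (C : Matrix (Fin p) (Fin n) ℝ) :
    VanishesTo 1 (ss A B C 0) := by
  rw [ss_eq, const_zero, add_zero]
  exact vanishesTo_const_res_const A B C

theorem isUnit_ss_one (B : Matrix (Fin n) (Fin m) ℝ) (C : Matrix (Fin m) (Fin n) ℝ) :
    IsUnit (ss A B C 1) := by
  rw [ss_eq, const_one, add_comm]
  exact isUnit_one_add (vanishesTo_const_res_const A B C)

theorem vanishesTo_inv_ss_one (B : Matrix (Fin n) (Fin m) ℝ) (C : Matrix (Fin m) (Fin n) ℝ) :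
    VanishesTo 0 (ss A B C 1)⁻¹ := by
  rw [ss_eq, const_one, add_comm]
  exact inv_vanishesTo (vanishesTo_const_res_const A B C)

theorem IsSchur.transpose {A : Matrix (Fin n) (Fin n) ℝ} (hA : IsSchur A) : IsSchur Aᵀ := by
  intro z hz
  refine hA z ?_
  rw [Matrix.mem_spectrum_iff_not_isUnit_eval_charpoly] at hz ⊢
  rwa [Matrix.transpose_map, Matrix.charpoly_transpose] at hz

/-- Entries are adjugate over characteristic polynomial, so every pole is an eigenvalue. -/
theorem IsSchur.isStable_res {A : Matrix (Fin n) (Fin n) ℝ} (hA : IsSchur A) :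
    IsStable (res A) := by
  refine ⟨vanishesTo_zero_iff.mp ((vanishesTo_res A).mono (by norm_num)), fun i j z hz => ?_⟩
  have h1 : (RatFunc.X : RatFunc ℝ) • (1 : TF n n) - const A =
      (algebraMap (Polynomial ℝ) (RatFunc ℝ)).mapMatrix A.charmatrix := by
    ext i j : 2
    by_cases hij : i = j
    · subst hij
      simp [Matrix.charmatrix_apply_eq, const]
    · simp [Matrix.charmatrix_apply_ne _ _ _ hij, const, Matrix.one_apply_ne hij]
  have h2 : res A i j = algebraMap _ _ (A.charmatrix.adjugate i j) / algebraMap _ _ A.charpoly := by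
    rw [res, h1, Matrix.inv_def, ← RingHom.map_adjugate, ← RingHom.map_det, Matrix.smul_apply,
      Ring.inverse_eq_inv, smul_eq_mul, mul_comm, div_eq_mul_inv]
    rfl
  rw [h2]
  refine aeval_ne_zero_of_dvd (RatFunc.denom_div_dvd _ _) fun h0 => ?_
  refine absurd (hA z ?_) (not_lt.mpr hz)
  rw [Matrix.mem_spectrum_iff_not_isUnit_eval_charpoly, Matrix.charpoly_map,
    Polynomial.eval_map_algebraMap, h0]
  simp

theorem IsSchur.isStable_ss {A : Matrix (Fin n) (Fin n) ℝ} (hA : IsSchur A)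
    (B : Matrix (Fin n) (Fin m) ℝ) (C : Matrix (Fin p) (Fin n) ℝ)
    (D : Matrix (Fin p) (Fin m) ℝ) : IsStable (ss A B C D) :=
  (((isStable_const C).mul hA.isStable_res).mul (isStable_const B)).add (isStable_const D)

end Resolvent

/-! ### Feedback, output injection and coprimeness -/

section Coprime

variable {n m p q : ℕ} (A : Matrix (Fin n) (Fin n) ℝ) (B : Matrix (Fin n) (Fin m) ℝ)
  (C : Matrix (Fin p) (Fin n) ℝ) (D : Matrix (Fin p) (Fin m) ℝ)
  (K : Matrix (Fin m) (Fin n) ℝ) (L : Matrix (Fin n) (Fin p) ℝ)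

/-- The resolvent identity: `z x = A' x + w` is the same state equation as `z x = A x + ((A' - A) x
+ w)`. -/
theorem res_mul_eq_of_res (A' : Matrix (Fin n) (Fin n) ℝ) (Z : TF n q) :
    res A' * Z = res A * ((const A' - const A) * (res A' * Z)) + res A * Z := by
  rw [← Matrix.mul_add, eq_res_mul_iff, X_smul_res_mul, Matrix.sub_mul]
  abel

/-- State feedback turns `ss A B C D` into a right factorization. -/
theorem ss_mul_ss_feedback :
    ss A B C D * ss (A + B * K) B K 1 = ss (A + B * K) B (C + D * K) D := by
  have h := congrArg (fun Z => const C * Z) (res_mul_eq_of_res A (A + B * K) (const B))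
  simp only [ss_eq, const_add, const_mul, const_one, Matrix.mul_add, Matrix.add_mul,
    Matrix.mul_assoc, add_sub_cancel_left, Matrix.mul_one] at h ⊢
  rw [h]
  abel

/-- Output injection is state feedback for the transposed system. -/
theorem ss_injection_mul_ss (D : Matrix (Fin p) (Fin m) ℝ) :
    ss (A + L * C) (-L) (-C) 1 * ss A B C D = ss (A + L * C) (B + L * D) C D := by
  have h := ss_mul_ss_feedback Aᵀ Cᵀ Bᵀ Dᵀ Lᵀ
  apply Matrix.transpose_injective
  rw [Matrix.transpose_mul, ss_neg_neg, ss_transpose, ss_transpose, ss_transpose]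
  simpa only [Matrix.transpose_add, Matrix.transpose_mul, Matrix.transpose_one] using h

/-- The resolvent identity between `A + L C` and `A + B K`, solved for the `B K` term. As a
rewriting rule it removes the products of two resolvents, which is all the Bézout identities need.
-/
theorem res_injection_mul_feedback (Z : TF n q) :
    res (A + L * C) * (const B * (const K * (res (A + B * K) * Z))) =
      res (A + B * K) * Z - res (A + L * C) * Z +
        res (A + L * C) * (const L * (const C * (res (A + B * K) * Z))) := by
  have h := res_mul_eq_of_res (A + L * C) (A + B * K) Z
  simp only [const_add, const_mul, Matrix.sub_mul, Matrix.mul_sub,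
    Matrix.mul_assoc, add_sub_add_left_eq_sub] at h ⊢
  conv_rhs => enter [1, 1]; rw [h]
  abel

/-- The Bézout identity behind the observer-based factorizations. -/
theorem bezout_identity :
    (1 - const K * res (A + L * C) * const B) * (1 + const K * res (A + B * K) * const B) +
      const K * res (A + L * C) * const L * (const C * res (A + B * K) * const B) = 1 := by
  simp only [Matrix.mul_add, Matrix.sub_mul, Matrix.mul_sub, Matrix.mul_assoc,
    Matrix.one_mul, Matrix.mul_one, res_injection_mul_feedback]
  abel

variable {A B C D}

/-- A detectable plant with `Dᵀ C = 0`, `Dᵀ D = I` has no zeros outside the unit disc: stability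
of `U Z` forces stability of `Z`. -/
theorem isStable_of_ss_mul (hDC : Dᵀ * C = 0) (hDD : Dᵀ * D = 1) (hd : Detectable A C)
    {Z : TF m q} (h : IsStable (ss (A + B * K) B (C + D * K) D * Z)) : IsStable Z := by
  obtain ⟨F, hF⟩ := hd
  set M : TF m m := 1 + const K * res (A + B * K) * const B with hM
  set H : TF p m := const C * res (A + B * K) * const B with hH
  set U := ss (A + B * K) B (C + D * K) D with hU
  have hU1 : U = H + const D * M := by
    rw [hU, ss_eq, hM, hH]
    simp only [const_add, const_mul, Matrix.mul_add, Matrix.add_mul, Matrix.mul_assoc,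
      Matrix.mul_one]
    abel
  have hDU : const Dᵀ * U = M := by
    rw [hU1, Matrix.mul_add, ← Matrix.mul_assoc _ (const D), ← const_mul, hDD, const_one,
      Matrix.one_mul, hH, ← Matrix.mul_assoc, ← Matrix.mul_assoc, ← const_mul, hDC, const_zero]
    simp
  have hUH : U - const D * (const Dᵀ * U) = H := by
    rw [hDU, hU1]; abel
  have hb := bezout_identity A B C K F
  -- `M` and `H` are right coprime by the Bézout identity for `F`. Since `Dᵀ U = M` and `U - D Dᵀ U
  -- = H`, both `M Z` and `H Z` are read off from `U Z`, and `Z` is a stable combination of them.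
  have hZ : Z = (1 - const K * res (A + F * C) * const B) * (const Dᵀ * (U * Z)) +
      const K * res (A + F * C) * const F * (U * Z - const D * (const Dᵀ * (U * Z))) := by
    rw [← Matrix.mul_assoc (const Dᵀ), ← Matrix.mul_assoc (const D), ← Matrix.sub_mul, hUH, hDU,
      ← Matrix.mul_assoc, ← Matrix.mul_assoc, ← Matrix.add_mul, hb, Matrix.one_mul]
  rw [hZ]
  have hS := hF.isStable_res
  have hc := fun {a b : ℕ} (M : Matrix (Fin a) (Fin b) ℝ) => isStable_const M
  exact ((isStable_one.sub (((hc _).mul hS).mul (hc _))).mul ((hc _).mul h)).add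
    ((((hc _).mul hS).mul (hc _)).mul (h.sub ((hc _).mul ((hc _).mul h))))

end Coprime

/-! ### State-space formulas for the factors and for `P₁₁` -/

namespace Plant

variable {n p1 p2 q1 q2 : ℕ} (P : Plant n p1 p2 q1 q2)
  (K : Matrix (Fin p2) (Fin n) ℝ) (L : Matrix (Fin n) (Fin q2) ℝ)

theorem G12_mul_Mhat : P.G12 * P.Mhat K = ss (P.A + P.B2 * K) P.B2 (P.C1 + P.D12 * K) P.D12 :=
  ss_mul_ss_feedback _ _ _ _ _

theorem P21_eq : P.P21 L = ss (P.A + L * P.C2) (P.B1 + L * P.D21) P.C2 P.D21 :=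
  ss_injection_mul_ss _ _ _ _ _

theorem G22_mul_Mhat : P.G22 * P.Mhat K = P.Nhat K := by
  have := ss_mul_ss_feedback P.A P.B2 P.C2 0 K
  rwa [Matrix.zero_mul, add_zero] at this

theorem Mtil_mul_G22 : P.Mtil L * P.G22 = P.Ntil L := by
  have := ss_injection_mul_ss P.A P.B2 P.C2 L 0
  rw [Matrix.mul_zero, add_zero] at this
  rw [Mtil, G22, this, Ntil, ss_eq, ss_eq]
  simp [const_neg, const_zero]

theorem bezout_blocks :
    Matrix.fromBlocks (P.Xtil K L) (-P.Ytil K L) (-P.Ntil L) (P.Mtil L) *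
      Matrix.fromBlocks (P.Mhat K) (P.Yhat K L) (P.Nhat K) (P.Xhat K L) = 1 := by
  rw [Matrix.fromBlocks_multiply, ← Matrix.fromBlocks_one]
  congr 1 <;>
  · simp only [Xtil, Ytil, Ntil, Mtil, Mhat, Yhat, Nhat, Xhat, ss_eq, const_neg, const_one,
      const_zero, Matrix.neg_mul, Matrix.mul_neg, neg_neg, Matrix.mul_add, Matrix.add_mul,
      Matrix.mul_assoc, Matrix.one_mul, Matrix.mul_one, add_zero, neg_add,
      res_injection_mul_feedback, Matrix.mul_sub]
    abel

theorem isDoublyCoprime (hK : IsSchur (P.A + P.B2 * K)) (hL : IsSchur (P.A + L * P.C2)) :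
    IsDoublyCoprime P.G22 (P.Mhat K) (P.Nhat K) (P.Xhat K L) (P.Yhat K L)
      (P.Mtil L) (P.Ntil L) (P.Xtil K L) (P.Ytil K L) where
  stable_Mh := hK.isStable_ss _ _ _
  stable_Nh := hK.isStable_ss _ _ _
  stable_Xh := hK.isStable_ss _ _ _
  stable_Yh := hK.isStable_ss _ _ _
  stable_Mt := hL.isStable_ss _ _ _
  stable_Nt := (hL.isStable_ss _ _ _).neg
  stable_Xt := hL.isStable_ss _ _ _
  stable_Yt := (hL.isStable_ss _ _ _).neg
  isUnit_Mh := isUnit_ss_one _ _ _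
  isUnit_Mt := isUnit_ss_one _ _ _
  right_fact := by
    rw [← G22_mul_Mhat, Matrix.mul_nonsing_inv_cancel_right]
    exact (Matrix.isUnit_iff_isUnit_det _).mp (isUnit_ss_one _ _ _)
  left_fact := by
    rw [← Mtil_mul_G22, Matrix.nonsing_inv_mul_cancel_left]
    exact (Matrix.isUnit_iff_isUnit_det _).mp (isUnit_ss_one _ _ _)
  bezout := P.bezout_blocks K L

/-- The estimation error response `(z I - A - L C₂)⁻¹ (B₁ + L D₂₁)`. -/
def errorState : TF n p1 := res (P.A + L * P.C2) * const (P.B1 + L * P.D21)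

/-- The response of the plant state under the central controller. -/
def plantState : TF n p1 :=
  res (P.A + P.B2 * K) * (const P.B1 - const P.B2 * (const K * P.errorState L))

theorem P21_eq_errorState : P.P21 L = const P.C2 * P.errorState L + const P.D21 := by
  rw [P21_eq, ss_eq, errorState, Matrix.mul_assoc]

theorem X_smul_errorState : (RatFunc.X : RatFunc ℝ) • P.errorState L =
    const (P.A + L * P.C2) * P.errorState L + const (P.B1 + L * P.D21) :=
  X_smul_res_mul _

theorem X_smul_plantState : (RatFunc.X : RatFunc ℝ) • P.plantState K L =
    const (P.A + P.B2 * K) * P.plantState K L +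
      (const P.B1 - const P.B2 * (const K * P.errorState L)) :=
  X_smul_res_mul _

/-- State-space form of `P₁₁`. -/
theorem P11_eq : P.P11 K L = const (P.C1 + P.D12 * K) * P.plantState K L -
    const P.D12 * (const K * P.errorState L) := by
  set e := P.errorState L with he
  set ξ := P.plantState K L with hξ
  -- Here `ξ - e` is the observer state, driven through `-L` by the innovation `P21`; applying `K`
  -- to it gives the control signal of `h2`.
  have h1 : e - ξ = res (P.A + P.B2 * K) * (const L * P.P21 L) := by
    rw [eq_res_mul_iff, smul_sub, X_smul_errorState, X_smul_plantState, P21_eq_errorState]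
    simp only [const_add, const_mul, Matrix.mul_add, Matrix.add_mul, Matrix.mul_sub,
      Matrix.mul_assoc, ← he, ← hξ]
    abel
  have h2 : P.Yhat K L * P.Mtil L * P.G21 = const K * (ξ - e) := by
    rw [Matrix.mul_assoc, ← P21, ← neg_sub e ξ, h1, Yhat, ss_eq]
    simp only [const_neg, const_zero, add_zero, Matrix.mul_assoc, Matrix.mul_neg, Matrix.neg_mul]
  -- The same `ξ` is the state of the original plant under the control `K (ξ - e)`.
  have h3 : ξ = res P.A * (const P.B1 + const P.B2 * (const K * (ξ - e))) := by
    rw [eq_res_mul_iff, X_smul_plantState]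
    simp only [const_add, const_mul, Matrix.add_mul, Matrix.mul_sub, Matrix.mul_assoc,
      ← he, ← hξ]
    abel
  rw [P11, Matrix.mul_assoc, Matrix.mul_assoc, ← Matrix.mul_assoc (P.Yhat K L), h2, G11, G12,
    ss_eq, ss_eq, const_zero, add_zero]
  have h4 : const P.C1 * res P.A * const P.B1 + (const P.C1 * res P.A * const P.B2 + const P.D12) *
      (const K * (ξ - e)) = const P.C1 * (res P.A * (const P.B1 + const P.B2 *
        (const K * (ξ - e)))) + const P.D12 * (const K * (ξ - e)) := by
    simp only [Matrix.mul_add, Matrix.add_mul, Matrix.mul_assoc]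
    abel
  rw [h4, ← h3]
  simp only [const_add, const_mul, Matrix.add_mul, Matrix.mul_sub, Matrix.mul_assoc]
  abel

end Plant

open Filter Topology

/-! ### The `H²` inner product -/

theorem trace_transpose_mul_self_nonneg (M : Matrix (Fin a) (Fin b) ℝ) :
    0 ≤ Matrix.trace (Mᵀ * M) := by
  rw [Matrix.trace]
  refine Finset.sum_nonneg fun i _ => ?_
  rw [Matrix.diag_apply, Matrix.mul_apply]
  exact Finset.sum_nonneg fun j _ => mul_self_nonneg _

theorem sq_le_trace (M : Matrix (Fin a) (Fin b) ℝ) (i : Fin a) (j : Fin b) :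
    M i j * M i j ≤ Matrix.trace (Mᵀ * M) := by
  rw [Matrix.trace]
  refine le_trans ?_ (Finset.single_le_sum (f := fun j => Matrix.diag (Mᵀ * M) j)
    (fun j _ => ?_) (Finset.mem_univ j))
  · simp only [Matrix.diag_apply, Matrix.mul_apply, Matrix.transpose_apply]
    exact Finset.single_le_sum (f := fun i => M i j * M i j) (fun _ _ => mul_self_nonneg _)
      (Finset.mem_univ i)
  · rw [Matrix.diag_apply, Matrix.mul_apply]
    exact Finset.sum_nonneg fun j _ => mul_self_nonneg _

/-- The real `H²` inner product of two transfer matrices. -/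
def ip (G H : TF a b) : ℝ := ∑' t, Matrix.trace ((markov G t)ᵀ * markov H t)

theorem IsStable.tendsto_markov {G : TF a b} (hG : IsStable G) :
    Tendsto (markov G) atTop (𝓝 0) := by
  refine tendsto_pi_nhds.mpr fun i => tendsto_pi_nhds.mpr fun j => ?_
  have := (isStable_iff.mp hG i j).summable_coeff.tendsto_atTop_zero
  exact tendsto_zero_iff_norm_tendsto_zero.mpr this

theorem IsStable.summable {G H : TF a b} (hG : IsStable G) (hH : IsStable H) :
    Summable fun t => Matrix.trace ((markov G t)ᵀ * markov H t) := by
  simp only [Matrix.trace, Matrix.diag_apply, Matrix.mul_apply, Matrix.transpose_apply]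
  refine summable_sum fun j _ => summable_sum fun i _ => ?_
  have h1 := (isStable_iff.mp hG i j).summable_coeff
  have h2 := (isStable_iff.mp hH i j).summable_coeff
  refine Summable.of_norm_bounded_eventually_nat h2 ?_
  filter_upwards [h1.tendsto_atTop_zero.eventually (gt_mem_nhds one_pos)] with t ht
  rw [norm_mul]
  exact mul_le_of_le_one_left (norm_nonneg _) ht.le

theorem ip_add_left {G G' H : TF a b} (hG : IsStable G) (hG' : IsStable G') (hH : IsStable H) :
    ip (G + G') H = ip G H + ip G' H := by
  rw [ip, ip, ip, ← (hG.summable hH).tsum_add (hG'.summable hH)]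
  refine tsum_congr fun t => ?_
  rw [markov_add, Matrix.transpose_add, Matrix.add_mul, Matrix.trace_add]

theorem ip_comm (G H : TF a b) : ip G H = ip H G := by
  refine tsum_congr fun t => ?_
  rw [← Matrix.trace_transpose, Matrix.transpose_mul, Matrix.transpose_transpose]

theorem ip_transpose (G H : TF a b) : ip Gᵀ Hᵀ = ip G H := by
  refine tsum_congr fun t => ?_
  rw [markov_transpose, markov_transpose, Matrix.transpose_transpose,
    ← Matrix.trace_transpose, Matrix.transpose_mul, Matrix.transpose_transpose,
    Matrix.trace_mul_comm]

theorem ip_add_self {G H : TF a b} (hG : IsStable G) (hH : IsStable H) (h : ip G H = 0) :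
    ip (G + H) (G + H) = ip G G + ip H H := by
  rw [ip_add_left hG hH (hG.add hH), ip_comm G, ip_comm H, ip_add_left hG hH hG,
    ip_add_left hG hH hH, h, ip_comm H G, h]
  ring

theorem h2NormSq_eq_tsum (G : TF a b) :
    h2NormSq G = ∑' t, ENNReal.ofReal (Matrix.trace ((markov G t)ᵀ * markov G t)) := by
  refine tsum_congr fun t => ?_
  rw [Matrix.trace_mul_comm]

theorem IsStable.h2NormSq_eq {G : TF a b} (hG : IsStable G) :
    h2NormSq G = ENNReal.ofReal (ip G G) := by
  rw [h2NormSq_eq_tsum, ip, ENNReal.ofReal_tsum_of_nonneg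
    (fun t => trace_transpose_mul_self_nonneg _) (hG.summable hG)]

theorem ip_self_nonneg (G : TF a b) : 0 ≤ ip G G :=
  tsum_nonneg fun _ => trace_transpose_mul_self_nonneg _

/-- Square summability makes every coefficient tend to zero, and for a proper rational function this
already excludes poles in `1 ≤ |z|`. -/
theorem isStable_of_h2NormSq_ne_top {G : TF a b} (hG : VanishesTo 0 G) (h : h2NormSq G ≠ ⊤) :
    IsStable G := by
  rw [h2NormSq_eq_tsum] at h
  have h0 := ENNReal.tendsto_atTop_zero_of_tsum_ne_top h
  rw [isStable_iff]
  intro i j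
  refine scalarStable_of_tendsto (degLE_zero_iff.mp (hG i j)) ?_
  have h1 : Tendsto (fun t => Matrix.trace ((markov G t)ᵀ * markov G t)) atTop (𝓝 0) := by
    have := (ENNReal.tendsto_toReal ENNReal.zero_ne_top).comp h0
    refine this.congr fun t => ?_
    exact ENNReal.toReal_ofReal (trace_transpose_mul_self_nonneg _)
  have h2 : Tendsto (fun t => markov G t i j * markov G t i j) atTop (𝓝 0) :=
    squeeze_zero (fun t => mul_self_nonneg _) (fun t => sq_le_trace _ i j) h1
  have h3 := h2.sqrt
  rw [Real.sqrt_zero] at h3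
  simp only [Real.sqrt_mul_self_eq_abs] at h3
  exact (tendsto_zero_iff_abs_tendsto_zero _).mpr h3

/-! ### Energy balance for lossless systems -/

/-- The system `x⁺ = F x + G u`, `y = H x + J u` conserves energy: the storage is `xᵀ X x` and the
supply is `uᵀ Om u - yᵀ y`. -/
structure Lossless {n m p : ℕ} (F : Matrix (Fin n) (Fin n) ℝ) (G : Matrix (Fin n) (Fin m) ℝ)
    (H : Matrix (Fin p) (Fin n) ℝ) (J : Matrix (Fin p) (Fin m) ℝ)
    (X : Matrix (Fin n) (Fin n) ℝ) (Om : Matrix (Fin m) (Fin m) ℝ) : Prop where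
  schur : IsSchur F
  symm : Xᵀ = X
  lyapunov : Fᵀ * X * F + Hᵀ * H = X
  cross : Fᵀ * X * G + Hᵀ * J = 0
  gain : Gᵀ * X * G + Jᵀ * J = Om

namespace Lossless

variable {n m p q : ℕ} {F : Matrix (Fin n) (Fin n) ℝ} {G : Matrix (Fin n) (Fin m) ℝ}
  {H : Matrix (Fin p) (Fin n) ℝ} {J : Matrix (Fin p) (Fin m) ℝ} {X : Matrix (Fin n) (Fin n) ℝ}
  {Om : Matrix (Fin m) (Fin m) ℝ}

/-- One step of the energy balance, in polarized form so that it gives inner products as well as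
norms; the defining identities match the four blocks of the expansion. -/
theorem step (h : Lossless F G H J X Om) (x x' : Matrix (Fin n) (Fin q) ℝ)
    (u u' : Matrix (Fin m) (Fin q) ℝ) :
    (H * x + J * u)ᵀ * (H * x' + J * u') + (F * x + G * u)ᵀ * X * (F * x' + G * u') =
      xᵀ * X * x' + uᵀ * Om * u' := by
  have hc : Gᵀ * X * F + Jᵀ * H = 0 := by
    have := congrArg Matrix.transpose h.cross
    simpa only [Matrix.transpose_add, Matrix.transpose_mul, Matrix.transpose_transpose, h.symm,
      Matrix.transpose_zero, Matrix.mul_assoc] using this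
  have e : xᵀ * X * x' + uᵀ * Om * u' = xᵀ * (Fᵀ * X * F + Hᵀ * H) * x' +
      xᵀ * (Fᵀ * X * G + Hᵀ * J) * u' + uᵀ * (Gᵀ * X * F + Jᵀ * H) * x' +
        uᵀ * (Gᵀ * X * G + Jᵀ * J) * u' := by
    rw [hc, h.cross, h.lyapunov, h.gain]
    simp
  rw [e]
  simp only [Matrix.transpose_add, Matrix.transpose_mul, Matrix.mul_add, Matrix.add_mul,
    Matrix.mul_assoc]
  abel

/-- The one-step balance telescopes and the final storage vanishes in the limit. -/
theorem tsum_energy (h : Lossless F G H J X Om) {x x' : ℕ → Matrix (Fin n) (Fin q) ℝ}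
    {u u' : ℕ → Matrix (Fin m) (Fin q) ℝ} (hx : ∀ t, x (t + 1) = F * x t + G * u t)
    (hx' : ∀ t, x' (t + 1) = F * x' t + G * u' t)
    (hlim : Tendsto x atTop (𝓝 0)) (hlim' : Tendsto x' atTop (𝓝 0))
    (hy : Summable fun t => Matrix.trace ((H * x t + J * u t)ᵀ * (H * x' t + J * u' t)))
    (hu : Summable fun t => Matrix.trace ((u t)ᵀ * Om * u' t)) :
    ∑' t, Matrix.trace ((H * x t + J * u t)ᵀ * (H * x' t + J * u' t)) =
      Matrix.trace ((x 0)ᵀ * X * x' 0) + ∑' t, Matrix.trace ((u t)ᵀ * Om * u' t) := by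
  have hfin : ∀ T, ∑ t ∈ Finset.range T,
      Matrix.trace ((H * x t + J * u t)ᵀ * (H * x' t + J * u' t)) +
        Matrix.trace ((x T)ᵀ * X * x' T) = Matrix.trace ((x 0)ᵀ * X * x' 0) +
          ∑ t ∈ Finset.range T, Matrix.trace ((u t)ᵀ * Om * u' t) := by
    intro T
    induction T with
    | zero => simp
    | succ T ih =>
      have := congrArg Matrix.trace (h.step (x T) (x' T) (u T) (u' T))
      rw [Matrix.trace_add, Matrix.trace_add, ← hx, ← hx'] at this
      rw [Finset.sum_range_succ, Finset.sum_range_succ, ← add_assoc, ← ih]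
      linarith
  have hend : Tendsto (fun T => Matrix.trace ((x T)ᵀ * X * x' T)) atTop (𝓝 0) := by
    have hcont : Continuous fun z : Matrix (Fin n) (Fin q) ℝ × Matrix (Fin n) (Fin q) ℝ =>
        Matrix.trace (z.1ᵀ * X * z.2) := by fun_prop
    have := (hcont.tendsto (0, 0)).comp (hlim.prodMk_nhds hlim')
    simpa [Function.comp_def] using this
  have h1 := hy.hasSum.tendsto_sum_nat.add hend
  have h2 := hu.hasSum.tendsto_sum_nat.const_add (Matrix.trace ((x 0)ᵀ * X * x' 0))
  rw [add_zero] at h1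
  exact tendsto_nhds_unique (h1.congr hfin) h2

theorem isStable_ss (h : Lossless F G H J X Om) : IsStable (ss F G H J) :=
  h.schur.isStable_ss _ _ _

/-- A lossless system is an isometry up to the weight `Om`. -/
theorem ip_mul_mul (h : Lossless F G H J X Om) {W W' : TF m q} (hW : IsStable W)
    (hW' : IsStable W') : ip (ss F G H J * W) (ss F G H J * W') = ip W (const Om * W') := by
  have hrec : ∀ (W : TF m q) t, markov (res F * (const G * W)) (t + 1) =
      F * markov (res F * (const G * W)) t + G * markov W t := by
    intro W t
    rw [← markov_X_smul, X_smul_res_mul, markov_add, markov_const_mul, markov_const_mul]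
  have hstab : ∀ {W : TF m q}, IsStable W → IsStable (res F * (const G * W)) := fun hW =>
    h.schur.isStable_res.mul ((isStable_const G).mul hW)
  have hout : ∀ (W : TF m q) t, markov (ss F G H J * W) t =
      H * markov (res F * (const G * W)) t + J * markov W t := by
    intro W t
    rw [ss_eq, Matrix.add_mul, Matrix.mul_assoc, Matrix.mul_assoc, markov_add, markov_const_mul,
      markov_const_mul]
  have hy := (h.isStable_ss.mul hW).summable (h.isStable_ss.mul hW')
  have hu := hW.summable ((isStable_const Om).mul hW')
  have hOm : ∀ t, (markov W t)ᵀ * markov (const Om * W') t = (markov W t)ᵀ * Om * markov W' t :=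
    fun t => by rw [markov_const_mul, Matrix.mul_assoc]
  simp only [hout] at hy
  simp only [hOm] at hu
  have key := h.tsum_energy (hrec W) (hrec W') (hstab hW).tendsto_markov
    (hstab hW').tendsto_markov hy hu
  have h0 : markov (res F * (const G * W)) 0 = 0 :=
    ((vanishesTo_res F).mul_proper
      ((vanishesTo_const G).proper_mul hW.vanishesTo)).markov_eq_zero (by norm_num)
  rw [h0] at key
  simp only [ip, hout, hOm]
  rw [key, Matrix.transpose_zero, Matrix.zero_mul, Matrix.zero_mul, Matrix.trace_zero, zero_add]

/-- An impulsive disturbance of the state is orthogonal to every response to a strictly proper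
input. -/
theorem ip_disturbed (h : Lossless F G H J X Om) {ξ : TF n q} {w W : TF m q}
    {B : Matrix (Fin n) (Fin q) ℝ} (hξ : IsStable ξ) (hw : IsStable w) (hW : IsStable W)
    (hξ1 : VanishesTo 1 ξ) (hw1 : VanishesTo 1 w) (hW1 : VanishesTo 1 W)
    (hrec : (RatFunc.X : RatFunc ℝ) • ξ = const F * ξ + (const B + const G * w)) :
    ip (const H * ξ + const J * w) (ss F G H J * W) = ip w (const Om * W) := by
  set η := res F * (const G * W) with hη
  have hηs : IsStable η := h.schur.isStable_res.mul ((isStable_const G).mul hW)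
  have hη2 : VanishesTo 2 η := by
    have := (vanishesTo_res F).mul ((vanishesTo_const G).proper_mul hW1)
    simpa using this
  have hx : ∀ t, markov ξ (t + 1 + 1) = F * markov ξ (t + 1) + G * markov w (t + 1) := by
    intro t
    rw [← markov_X_smul, hrec, markov_add, markov_add, markov_const_mul, markov_const_mul,
      markov_const, if_neg (Nat.succ_ne_zero t), zero_add]
  have hx' : ∀ t, markov η (t + 1 + 1) = F * markov η (t + 1) + G * markov W (t + 1) := by
    intro t
    rw [← markov_X_smul, hη, X_smul_res_mul, markov_add, markov_const_mul, markov_const_mul]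
  have hout : ∀ t, markov (const H * ξ + const J * w) t = H * markov ξ t + J * markov w t := by
    intro t
    rw [markov_add, markov_const_mul, markov_const_mul]
  have hout' : ∀ t, markov (ss F G H J * W) t = H * markov η t + J * markov W t := by
    intro t
    rw [ss_eq, Matrix.add_mul, Matrix.mul_assoc, Matrix.mul_assoc, markov_add, markov_const_mul,
      markov_const_mul]
  have hy := (((isStable_const H).mul hξ).add ((isStable_const J).mul hw)).summable
    (h.isStable_ss.mul hW)
  have hu := hw.summable ((isStable_const Om).mul hW)
  -- Time 0 is split off because `B` acts in passing to time 1. From time 1 on the balance is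
  -- undisturbed, and its initial storage is zero because `η` has order 2.
  rw [ip, ip, hy.tsum_eq_zero_add, hu.tsum_eq_zero_add]
  have hy1 := (summable_nat_add_iff 1).mpr hy
  have hu1 := (summable_nat_add_iff 1).mpr hu
  simp only [hout, hout'] at hy1 ⊢
  simp only [markov_const_mul, ← Matrix.mul_assoc] at hu1 ⊢
  have key := h.tsum_energy (x := fun t => markov ξ (t + 1)) (x' := fun t => markov η (t + 1))
    (u := fun t => markov w (t + 1)) (u' := fun t => markov W (t + 1)) hx hx'
    (hξ.tendsto_markov.comp (tendsto_add_atTop_nat 1))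
    (hηs.tendsto_markov.comp (tendsto_add_atTop_nat 1)) hy1 hu1
  rw [key, hξ1.markov_eq_zero (t := 0) (by norm_num), hw1.markov_eq_zero (t := 0) (by norm_num),
    hη2.markov_eq_zero (t := 0 + 1) (by norm_num)]
  simp

/-- `vᵀ X v` is the output energy of the free response from the state `v`. -/
theorem posSemidef (h : Lossless F G H J X Om) : X.PosSemidef := by
  refine Matrix.PosSemidef.of_dotProduct_mulVec_nonneg h.symm fun v => ?_
  set V : Matrix (Fin n) (Fin 1) ℝ := Matrix.of fun i _ => v i with hV
  set ξ := res F * const V with hξ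
  have hξs : IsStable ξ := h.schur.isStable_res.mul (isStable_const V)
  have hx : ∀ t, markov ξ (t + 1 + 1) =
      F * markov ξ (t + 1) + G * (0 : ℕ → Matrix (Fin m) (Fin 1) ℝ) t := by
    intro t
    rw [← markov_X_smul, hξ, X_smul_res_mul, markov_add, markov_const_mul, markov_const,
      if_neg (Nat.succ_ne_zero t), Pi.zero_apply, Matrix.mul_zero]
  have hξ1 : markov ξ 1 = V := by
    change markov ξ (0 + 1) = V
    rw [← markov_X_smul, hξ, X_smul_res_mul, markov_add, markov_const_mul,
      markov_const, if_pos rfl, ((vanishesTo_res F).mul_proper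
        (vanishesTo_const V)).markov_eq_zero (by norm_num), Matrix.mul_zero, zero_add]
  have hlim := hξs.tendsto_markov.comp (tendsto_add_atTop_nat 1)
  have hy := (((isStable_const H).mul hξs)).summable ((isStable_const H).mul hξs)
  have hy1 := (summable_nat_add_iff 1).mpr hy
  simp only [markov_const_mul] at hy1
  have key := h.tsum_energy (u := 0) (u' := 0) hx hx hlim hlim
    (by simpa using hy1) (by simp)
  have h1 : 0 ≤ ∑' t, Matrix.trace ((H * markov ξ (t + 1))ᵀ * (H * markov ξ (t + 1))) :=
    tsum_nonneg fun _ => trace_transpose_mul_self_nonneg _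
  simp only [Function.comp_apply, Pi.zero_apply, Matrix.mul_zero, add_zero, zero_add, hξ1,
    Matrix.trace_zero, tsum_zero] at key
  rw [key] at h1
  have h2 : Matrix.trace (Vᵀ * X * V) = star v ⬝ᵥ X *ᵥ v := by
    rw [Matrix.trace_fin_one, Matrix.mul_assoc, Matrix.mul_apply]
    rfl
  rwa [h2] at h1

theorem gain_nonneg (h : Lossless F G H J X Om) : 0 ≤ Om := by
  rw [Matrix.nonneg_iff_posSemidef, ← h.gain]
  have h1 := h.posSemidef.conjTranspose_mul_mul_same G
  have h2 := Matrix.posSemidef_conjTranspose_mul_self J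
  rw [Matrix.conjTranspose_eq_transpose_of_trivial] at h1 h2
  exact h1.add h2

end Lossless

/-- A stabilizing Riccati solution makes the optimally controlled system lossless. -/
theorem lossless_of_riccati {n m p : ℕ} {A X : Matrix (Fin n) (Fin n) ℝ}
    {B : Matrix (Fin n) (Fin m) ℝ} {C : Matrix (Fin p) (Fin n) ℝ} {D : Matrix (Fin p) (Fin m) ℝ}
    {K : Matrix (Fin m) (Fin n) ℝ} (hDC : Dᵀ * C = 0) (hDD : Dᵀ * D = 1) (hX : Xᵀ = X)
    (hu : IsUnit (1 + Bᵀ * X * B))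
    (hric : X = Cᵀ * C + Aᵀ * X * A - Aᵀ * X * B * (1 + Bᵀ * X * B)⁻¹ * Bᵀ * X * A)
    (hK : K = -((1 + Bᵀ * X * B)⁻¹ * Bᵀ * X * A)) (hS : IsSchur (A + B * K)) :
    Lossless (A + B * K) B (C + D * K) D X (1 + Bᵀ * X * B) := by
  set Om := 1 + Bᵀ * X * B with hOm
  have hdet := (Matrix.isUnit_iff_isUnit_det _).mp hu
  have hOmT : Omᵀ = Om := by
    rw [hOm]
    simp only [Matrix.transpose_add, Matrix.transpose_one, Matrix.transpose_mul,
      Matrix.transpose_transpose, hX, Matrix.mul_assoc]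
  -- The definition of the gain in product form; together with its transpose it removes the inverse
  -- of `Om` from the Riccati equation.
  have h1 : Bᵀ * (X * A) = -(Om * K) := by
    rw [hK, Matrix.mul_neg, neg_neg, Matrix.mul_assoc, Matrix.mul_assoc,
      Matrix.mul_nonsing_inv_cancel_left _ _ hdet]
  have h2 : Aᵀ * (X * B) = -(Kᵀ * Om) := by
    have := congrArg Matrix.transpose h1
    simpa only [Matrix.transpose_mul, Matrix.transpose_transpose, Matrix.transpose_neg, hX, hOmT,
      Matrix.mul_assoc] using this
  have h3 : Bᵀ * (X * B) = Om - 1 := by rw [hOm, Matrix.mul_assoc]; abel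
  have h4 : Cᵀ * D = 0 := by
    have := congrArg Matrix.transpose hDC
    simpa only [Matrix.transpose_mul, Matrix.transpose_transpose, Matrix.transpose_zero] using this
  have h5 : X = Cᵀ * C + Aᵀ * (X * A) + -(Kᵀ * (Om * K)) := by
    have e : Aᵀ * X * B * Om⁻¹ * Bᵀ * X * A = Kᵀ * (Om * K) := by
      have : Aᵀ * X * B * Om⁻¹ * Bᵀ * X * A = Aᵀ * (X * B) * -K := by
        rw [hK]; simp only [Matrix.mul_assoc, neg_neg]
      rw [this, h2, Matrix.neg_mul, Matrix.mul_neg, neg_neg, Matrix.mul_assoc]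
    rw [e, Matrix.mul_assoc, sub_eq_add_neg] at hric
    exact hric
  refine ⟨hS, hX, ?_, ?_, ?_⟩
  · conv_rhs => rw [h5]
    have h4' := congrArg (fun M => M * K) h4
    have hDC' := congrArg (fun M => Kᵀ * M) hDC
    have hDD' := congrArg (fun M => Kᵀ * (M * K)) hDD
    have h1' := congrArg (fun M => Kᵀ * M) h1
    have h2' := congrArg (fun M => M * K) h2
    have h3' := congrArg (fun M => Kᵀ * (M * K)) h3
    simp only [Matrix.mul_assoc, Matrix.sub_mul, Matrix.mul_sub, Matrix.neg_mul, Matrix.mul_neg,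
      Matrix.one_mul, Matrix.zero_mul, Matrix.mul_zero] at h4' hDC' hDD' h1' h2' h3'
    simp only [Matrix.transpose_add, Matrix.transpose_mul, Matrix.mul_add, Matrix.add_mul,
      Matrix.mul_assoc, h1', h2', h3', h4', hDC', hDD']
    abel
  · simp only [Matrix.transpose_add, Matrix.transpose_mul, Matrix.add_mul, Matrix.mul_assoc, h2,
      h3, h4, hDD, Matrix.mul_sub, Matrix.mul_one]
    abel
  · rw [hDD, hOm, add_comm]

/-! ### The weighted quadratic cost -/

/-- The squared norm `‖S V T‖²` of a weighted transfer matrix. -/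
def weightedCost {a b : ℕ} (S : Matrix (Fin a) (Fin a) ℝ) (T : Matrix (Fin b) (Fin b) ℝ)
    (V : TF a b) : ℝ≥0∞ := h2NormSq (const S * V * const T)

section Weighted

variable {S : Matrix (Fin a) (Fin a) ℝ} {T : Matrix (Fin b) (Fin b) ℝ}

theorem weightedCost_eq_tsum (V : TF a b) : weightedCost S T V =
    ∑' t, ENNReal.ofReal (Matrix.trace ((S * markov V t * T)ᵀ * (S * markov V t * T))) := by
  rw [weightedCost, h2NormSq_eq_tsum]
  simp only [markov_mul_const, markov_const_mul]

theorem weightedCost_zero : weightedCost S T 0 = 0 := by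
  simp [weightedCost_eq_tsum, markov_zero]

/-- FIR and delayed parts with disjoint supports are orthogonal. -/
theorem weightedCost_add {U V : TF a b} (h : ∀ t, markov U t = 0 ∨ markov V t = 0) :
    weightedCost S T (U + V) = weightedCost S T U + weightedCost S T V := by
  rw [weightedCost_eq_tsum, weightedCost_eq_tsum, weightedCost_eq_tsum, ← ENNReal.tsum_add]
  refine tsum_congr fun t => ?_
  rw [markov_add]
  rcases h t with h | h <;> simp [h]

theorem trace_transpose_mul_self_eq_zero {M : Matrix (Fin a) (Fin b) ℝ}
    (h : Matrix.trace (Mᵀ * M) = 0) : M = 0 := by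
  ext i j
  have h1 := sq_le_trace M i j
  rw [h] at h1
  exact mul_self_eq_zero.mp (le_antisymm h1 (mul_self_nonneg _))

theorem eq_zero_of_mul_mul_eq_zero (hS : IsUnit S) (hT : IsUnit T) {M : Matrix (Fin a) (Fin b) ℝ}
    (h : S * M * T = 0) : M = 0 := by
  have hS' := (Matrix.isUnit_iff_isUnit_det _).mp hS
  have hT' := (Matrix.isUnit_iff_isUnit_det _).mp hT
  have := congrArg (fun Z => S⁻¹ * (Z * T⁻¹)) h
  simpa [Matrix.mul_nonsing_inv_cancel_right _ _ hT', Matrix.nonsing_inv_mul_cancel_left _ _ hS']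
    using this

theorem eq_zero_of_weightedCost_eq_zero (hS : IsUnit S) (hT : IsUnit T) {V : TF a b}
    (hV : VanishesTo 0 V) (h : weightedCost S T V = 0) : V = 0 := by
  rw [weightedCost_eq_tsum, ENNReal.tsum_eq_zero] at h
  refine eq_zero_of_markov hV fun t => eq_zero_of_mul_mul_eq_zero hS hT ?_
  exact trace_transpose_mul_self_eq_zero
    (le_antisymm (ENNReal.ofReal_eq_zero.mp (h t)) (trace_transpose_mul_self_nonneg _))

theorem weightedCost_lt_top {V : TF a b} (hV : IsStable V) : weightedCost S T V < ⊤ := by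
  rw [weightedCost, IsStable.h2NormSq_eq
    (((isStable_const S).mul hV).mul (isStable_const T))]
  exact ENNReal.ofReal_lt_top

theorem weightedCost_eq_ip (hS : Sᵀ = S) (hT : Tᵀ = T) {V : TF a b} (hV : IsStable V) :
    weightedCost S T V = ENNReal.ofReal (ip V (const (S * S) * V * const (T * T))) := by
  rw [weightedCost, IsStable.h2NormSq_eq (((isStable_const S).mul hV).mul (isStable_const T))]
  congr 1
  refine tsum_congr fun t => ?_
  simp only [markov_mul_const, markov_const_mul, Matrix.transpose_mul, hS, hT]
  rw [Matrix.mul_assoc, Matrix.trace_mul_comm]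
  simp only [Matrix.mul_assoc]

end Weighted

/-! ### Minimization of a positive definite quadratic form on an affine subspace -/

/-- On a finite-dimensional subspace, a form that is definite there has a representer. -/
theorem exists_orthogonal {E : Type*} [AddCommGroup E] [Module ℝ E] (B : E →ₗ[ℝ] E →ₗ[ℝ] ℝ)
    (M : Submodule ℝ E) [FiniteDimensional ℝ M] (hdef : ∀ m ∈ M, B m m = 0 → m = 0) (v : E) :
    ∃ m ∈ M, ∀ m' ∈ M, B (v + m) m' = 0 := by
  -- Definiteness makes this map from `M` to its dual injective, hence surjective by dimension; `m`
  -- is a preimage of minus the functional given by `v`.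
  set φ : M →ₗ[ℝ] Module.Dual ℝ M := (LinearMap.lcomp ℝ ℝ M.subtype).comp (B.comp M.subtype)
    with hφ
  have hinj : Function.Injective φ := by
    rw [injective_iff_map_eq_zero]
    intro m hm
    have := LinearMap.congr_fun hm m
    exact Subtype.ext (hdef m m.2 this)
  have hsurj := (LinearMap.injective_iff_surjective_of_finrank_eq_finrank
    (Subspace.dual_finrank_eq (K := ℝ) (V := M)).symm).mp hinj
  obtain ⟨m, hm⟩ := hsurj (-((B v).comp M.subtype))
  refine ⟨m, m.2, fun m' hm' => ?_⟩
  have := LinearMap.congr_fun hm ⟨m', hm'⟩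
  have h2 : B m m' = -B v m' := this
  rw [map_add, LinearMap.add_apply, h2, add_neg_cancel]

/-! ### Losslessness of the plant and orthogonal splitting of the cost -/

namespace Plant

variable {n p1 p2 q1 q2 : ℕ} {P : Plant n p1 p2 q1 q2} {X Y : Matrix (Fin n) (Fin n) ℝ}
  {K : Matrix (Fin p2) (Fin n) ℝ} {L : Matrix (Fin n) (Fin q2) ℝ}

theorem qpCost_eq (V : TF p2 q2) :
    P.qpCost X Y V = weightedCost (CFC.sqrt (P.Om X)) (CFC.sqrt (P.Psi Y)) V := rfl

/-- The system `G₁₂ M̂` is lossless for the storage `X`. -/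
abbrev RegulatorLossless (P : Plant n p1 p2 q1 q2) (K : Matrix (Fin p2) (Fin n) ℝ)
    (X : Matrix (Fin n) (Fin n) ℝ) : Prop :=
  Lossless (P.A + P.B2 * K) P.B2 (P.C1 + P.D12 * K) P.D12 X (P.Om X)

/-- The transpose of `M̃ G₂₁` is lossless for the storage `Y`. -/
abbrev FilterLossless (P : Plant n p1 p2 q1 q2) (L : Matrix (Fin n) (Fin q2) ℝ)
    (Y : Matrix (Fin n) (Fin n) ℝ) : Prop :=
  Lossless (P.A + L * P.C2)ᵀ P.C2ᵀ (P.B1 + L * P.D21)ᵀ P.D21ᵀ Y (P.Psi Y)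

theorem IsStabilizingX.lossless (hP : P.Regular) (hX : P.IsStabilizingX X) (hK : K = P.gainK X) :
    P.RegulatorLossless K X :=
  lossless_of_riccati hP.D12_C1 hP.D12_D12 hX.symm hX.isUnit hX.riccati hK (hK ▸ hX.schur)

/-- The filter Riccati equation is the regulator equation of the transposed plant, with gain `Lᵀ`.
-/
theorem IsStabilizingY.lossless (hP : P.Regular) (hY : P.IsStabilizingY Y) (hL : L = P.gainL Y) :
    P.FilterLossless L Y := by
  have hPsi : (P.Psi Y)ᵀ = P.Psi Y := by
    simp only [Psi, Matrix.transpose_add, Matrix.transpose_one, Matrix.transpose_mul,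
      Matrix.transpose_transpose, Matrix.mul_assoc]
    rw [hY.symm.eq]
  have h := lossless_of_riccati (A := P.Aᵀ) (X := Y) (B := P.C2ᵀ) (C := P.B1ᵀ) (D := P.D21ᵀ)
    (K := Lᵀ) ?_ ?_ hY.symm ?_ ?_ ?_ ?_
  · simpa only [Matrix.transpose_add, Matrix.transpose_mul, Matrix.transpose_transpose, Psi,
      FilterLossless] using h
  · rw [Matrix.transpose_transpose]; exact hP.D21_B1
  · rw [Matrix.transpose_transpose]; exact hP.D21_D21
  · rw [Matrix.transpose_transpose]; exact hY.isUnit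
  · simpa only [Matrix.transpose_transpose] using hY.riccati
  · have hinv : ((P.Psi Y)⁻¹)ᵀ = (P.Psi Y)⁻¹ := by rw [Matrix.transpose_nonsing_inv, hPsi]
    rw [Matrix.transpose_transpose, ← Psi, hL, gainL, Matrix.transpose_neg]
    simp only [Matrix.transpose_mul, Matrix.transpose_transpose, hinv, hY.symm.eq,
      Matrix.mul_assoc]
  · have := (hL ▸ hY.schur : IsSchur (P.A + L * P.C2)).transpose
    simpa only [Matrix.transpose_add, Matrix.transpose_mul] using this

theorem P21_transpose : (P.P21 L)ᵀ =
    ss (P.A + L * P.C2)ᵀ P.C2ᵀ (P.B1 + L * P.D21)ᵀ P.D21ᵀ := by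
  rw [P21_eq, ss_transpose]

theorem P12_eq : P.P12 K = -ss (P.A + P.B2 * K) P.B2 (P.C1 + P.D12 * K) P.D12 := by
  rw [P12, G12_mul_Mhat]

theorem isStable_P12 (hX : P.RegulatorLossless K X) : IsStable (P.P12 K) :=
  P12_eq (P := P) ▸ hX.isStable_ss.neg

theorem isSchur_injection (hY : P.FilterLossless L Y) : IsSchur (P.A + L * P.C2) := by
  simpa using hY.schur.transpose

theorem isStable_P21 (hY : P.FilterLossless L Y) : IsStable (P.P21 L) := by
  have := hY.isStable_ss.transpose
  rwa [← P21_transpose, Matrix.transpose_transpose] at this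

theorem isStable_errorState (hY : P.FilterLossless L Y) : IsStable (P.errorState L) :=
  (isSchur_injection hY).isStable_res.mul (isStable_const _)

theorem vanishesTo_errorState : VanishesTo 1 (P.errorState L) :=
  (vanishesTo_res _).mul_proper (vanishesTo_const _)

/-- The estimation error is orthogonal to strictly proper functions of the innovation. -/
theorem ip_errorState (hY : P.FilterLossless L Y) (M : Matrix (Fin p2) (Fin n) ℝ)
    {Q : TF p2 q2} (hQ : IsStable Q)
    (hQ1 : VanishesTo 1 Q) : ip (const M * P.errorState L) (Q * P.P21 L) = 0 := by
  rw [← ip_transpose, Matrix.transpose_mul, Matrix.transpose_mul, P21_transpose]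
  have hrec := X_smul_res_mul (A := (P.A + L * P.C2)ᵀ) (const Mᵀ)
  -- In the transposed system `M` becomes an impulsive disturbance with no further input, so with `w
  -- = 0` the right-hand side is zero.
  have h := hY.ip_disturbed (ξ := res (P.A + L * P.C2)ᵀ * const Mᵀ) (w := 0) (W := Qᵀ) (B := Mᵀ)
    (hY.schur.isStable_res.mul (isStable_const _)) isStable_zero hQ.transpose
    ((vanishesTo_res _).mul_proper (vanishesTo_const _)) (vanishesTo_zero _) hQ1.transpose
    (by rw [hrec, Matrix.mul_zero, add_zero])
  have e : (P.errorState L)ᵀ * (const M)ᵀ = const (P.B1 + L * P.D21)ᵀ *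
      (res (P.A + L * P.C2)ᵀ * const Mᵀ) + const P.D21ᵀ * (0 : TF q2 p2) := by
    rw [errorState, Matrix.transpose_mul, res_transpose, const_transpose, const_transpose,
      Matrix.mul_assoc, Matrix.mul_zero, add_zero]
  rw [e, h, ip]
  simp [markov_zero]

theorem isStable_plantState (hX : P.RegulatorLossless K X) (hY : P.FilterLossless L Y)
    : IsStable (P.plantState K L) :=
  hX.schur.isStable_res.mul ((isStable_const _).sub
    ((isStable_const _).mul ((isStable_const _).mul (isStable_errorState hY))))

theorem vanishesTo_plantState (hY : P.FilterLossless L Y) : VanishesTo 1 (P.plantState K L) :=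
  (vanishesTo_res _).mul_proper ((vanishesTo_const _).sub
    ((vanishesTo_const _).mul_proper
      ((vanishesTo_const _).mul_proper (isStable_errorState hY).vanishesTo)))

theorem isStable_P11 (hX : P.RegulatorLossless K X) (hY : P.FilterLossless L Y)
    : IsStable (P.P11 K L) := by
  rw [P11_eq]
  exact ((isStable_const _).mul (isStable_plantState hX hY)).sub
    ((isStable_const _).mul ((isStable_const _).mul (isStable_errorState hY)))

theorem isStable_P12_mul_P21 (hX : P.RegulatorLossless K X) (hY : P.FilterLossless L Y)
    {Q : TF p2 q2} (hQ : IsStable Q) :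
    IsStable (P.P12 K * Q * P.P21 L) :=
  ((isStable_P12 hX).mul hQ).mul (isStable_P21 hY)

/-- `P11` is the regulator response to the impulse `B₁` with input `-K e`. Losslessness moves the
inner product onto the inputs, where the estimation error `e` is orthogonal to strictly proper
functions of the innovation. -/
theorem ip_P11 (hX : P.RegulatorLossless K X) (hY : P.FilterLossless L Y)
    {Q : TF p2 q2} (hQ : IsStable Q) (hQ1 : VanishesTo 1 Q) :
    ip (P.P11 K L) (P.P12 K * Q * P.P21 L) = 0 := by
  have he := isStable_errorState hY
  have he1 := vanishesTo_errorState (P := P) (L := L)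
  have hP21 := isStable_P21 hY
  have h := hX.ip_disturbed (ξ := P.plantState K L) (w := -(const K * P.errorState L))
    (W := -Q * P.P21 L) (B := P.B1) (isStable_plantState hX hY)
    ((isStable_const _).mul he).neg (hQ.neg.mul hP21) (vanishesTo_plantState hY)
    ((vanishesTo_const _).proper_mul he1).neg (hQ1.neg.mul_proper hP21.vanishesTo)
    (by rw [X_smul_plantState, Matrix.mul_neg, sub_eq_add_neg])
  have e1 : P.P11 K L = const (P.C1 + P.D12 * K) * P.plantState K L +
      const P.D12 * -(const K * P.errorState L) := by
    rw [P11_eq, Matrix.mul_neg, sub_eq_add_neg]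
  have e2 : P.P12 K * Q * P.P21 L =
      ss (P.A + P.B2 * K) P.B2 (P.C1 + P.D12 * K) P.D12 * (-Q * P.P21 L) := by
    rw [P12_eq, Matrix.neg_mul, Matrix.neg_mul, Matrix.neg_mul, Matrix.mul_neg, Matrix.mul_assoc]
  rw [e1, e2, h, ← Matrix.mul_assoc]
  have e3 : -(const K * P.errorState L) = const (-K) * P.errorState L := by
    rw [const_neg, Matrix.neg_mul]
  rw [e3]
  exact ip_errorState hY _ ((isStable_const _).mul hQ.neg) ((vanishesTo_const _).proper_mul hQ1.neg)

/-- The regulator removes `P12` at the price of `Ω`; after transposition the filter removes `P21` at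
the price of `Ψ`. -/
theorem ip_P12_mul_P21 (hX : P.RegulatorLossless K X) (hY : P.FilterLossless L Y)
    {Q : TF p2 q2} (hQ : IsStable Q) :
    ip (P.P12 K * Q * P.P21 L) (P.P12 K * Q * P.P21 L) =
      ip Q (const (P.Om X) * Q * const (P.Psi Y)) := by
  have hP21 := isStable_P21 hY
  have e2 : P.P12 K * Q * P.P21 L =
      ss (P.A + P.B2 * K) P.B2 (P.C1 + P.D12 * K) P.D12 * (-Q * P.P21 L) := by
    rw [P12_eq, Matrix.neg_mul, Matrix.neg_mul, Matrix.neg_mul, Matrix.mul_neg, Matrix.mul_assoc]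
  have hPsi : (P.Psi Y)ᵀ = P.Psi Y := by
    simp only [Psi, Matrix.transpose_add, Matrix.transpose_one, Matrix.transpose_mul,
      Matrix.transpose_transpose, Matrix.mul_assoc]
    rw [hY.symm]
  rw [e2, hX.ip_mul_mul (hQ.neg.mul hP21) (hQ.neg.mul hP21), ← Matrix.mul_assoc, ← ip_transpose,
    Matrix.transpose_mul, Matrix.transpose_mul, P21_transpose,
    hY.ip_mul_mul hQ.neg.transpose ((isStable_const _).mul hQ.neg).transpose]
  have e4 : const (P.Psi Y) * (const (P.Om X) * -Q)ᵀ =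
      (const (P.Om X) * -Q * const (P.Psi Y))ᵀ := by
    rw [Matrix.transpose_mul _ (const (P.Psi Y)), ← const_transpose, hPsi]
  rw [e4, ip_transpose]
  refine tsum_congr fun t => ?_
  simp only [Matrix.mul_neg, Matrix.neg_mul, markov_neg, Matrix.transpose_neg, neg_neg]

theorem sqrt_spec {m : ℕ} {M : Matrix (Fin m) (Fin m) ℝ} (h : 0 ≤ M) (hu : IsUnit M) :
    CFC.sqrt M * CFC.sqrt M = M ∧ (CFC.sqrt M)ᵀ = CFC.sqrt M ∧ IsUnit (CFC.sqrt M) := by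
  have h1 := CFC.sqrt_mul_sqrt_self M h
  refine ⟨h1, ?_, ?_⟩
  · have := (Matrix.nonneg_iff_posSemidef.mp (CFC.sqrt_nonneg M)).isHermitian
    rwa [Matrix.IsHermitian, Matrix.conjTranspose_eq_transpose_of_trivial] at this
  · rw [← h1] at hu
    exact isUnit_of_mul_isUnit_left hu

theorem h2NormSq_P12_mul_P21 (hX : P.RegulatorLossless K X) (hY : P.FilterLossless L Y)
    (hXu : IsUnit (P.Om X)) (hYu : IsUnit (P.Psi Y)) {Q : TF p2 q2}
    (hQ : IsStable Q) : h2NormSq (P.P12 K * Q * P.P21 L) = P.qpCost X Y Q := by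
  obtain ⟨h1, h2, -⟩ := sqrt_spec hX.gain_nonneg hXu
  obtain ⟨h3, h4, -⟩ := sqrt_spec hY.gain_nonneg hYu
  rw [qpCost_eq, weightedCost_eq_ip h2 h4 hQ, h1, h3,
    (isStable_P12_mul_P21 hX hY hQ).h2NormSq_eq, ip_P12_mul_P21 hX hY hQ]

/-- Orthogonality of the central cost and the strictly proper Youla terms. -/
theorem h2NormSq_P11_add (hX : P.RegulatorLossless K X) (hY : P.FilterLossless L Y)
    (hXu : IsUnit (P.Om X)) (hYu : IsUnit (P.Psi Y)) {Q : TF p2 q2}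
    (hQ : IsStable Q) (hQ1 : VanishesTo 1 Q) :
    h2NormSq (P.P11 K L + P.P12 K * Q * P.P21 L) = h2NormSq (P.P11 K L) + P.qpCost X Y Q := by
  have h1 := isStable_P11 hX hY
  have h2 := isStable_P12_mul_P21 hX hY hQ
  rw [← h2NormSq_P12_mul_P21 hX hY hXu hYu hQ, (h1.add h2).h2NormSq_eq, h1.h2NormSq_eq,
    h2.h2NormSq_eq, ip_add_self h1 h2 (ip_P11 hX hY hQ hQ1),
    ENNReal.ofReal_add (ip_self_nonneg _) (ip_self_nonneg _)]

/-- `P12` is cancelled using detectability of `(A, C₁)`, then `P21` by duality using stabilizability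
of `(A, B₁)`. -/
theorem isStable_of_P12_mul_P21 (hP : P.Regular) {Q : TF p2 q2}
    (h : IsStable (P.P12 K * Q * P.P21 L)) : IsStable Q := by
  have h1 : IsStable (Q * P.P21 L) := by
    refine isStable_of_ss_mul (A := P.A) (B := P.B2) K hP.D12_C1 hP.D12_D12 hP.detectable_C1 ?_
    have := h.neg
    rwa [P12_eq, Matrix.neg_mul, Matrix.neg_mul, neg_neg, Matrix.mul_assoc] at this
  have h2 : Detectable P.Aᵀ P.B1ᵀ := by
    obtain ⟨F, hF⟩ := hP.stabilizable_B1
    refine ⟨Fᵀ, ?_⟩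
    simpa only [Matrix.transpose_add, Matrix.transpose_mul] using hF.transpose
  have h3 : IsStable Qᵀ := by
    refine isStable_of_ss_mul (A := P.Aᵀ) (B := P.C2ᵀ) (C := P.B1ᵀ) (D := P.D21ᵀ) Lᵀ ?_ ?_ h2 ?_
    · rw [Matrix.transpose_transpose]; exact hP.D21_B1
    · rw [Matrix.transpose_transpose]; exact hP.D21_D21
    · have := h1.transpose
      rw [Matrix.transpose_mul, P21_transpose] at this
      simpa only [Matrix.transpose_add, Matrix.transpose_mul] using this
  exact h3.transpose

end Plant

/-! ### The quadratic program -/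

section QuadraticProgram

theorem markov_smul (r : ℝ) (V : TF a b) (t : ℕ) : markov (r • V) t = r • markov V t := by
  ext i j
  rw [markov_apply, Matrix.smul_apply, RatFunc.smul_eq_C_mul, coeff_expansion_C_mul]
  rfl

/-- The Markov parameters with index in `s`, as a linear map. -/
def markovMap (a b : ℕ) (s : Finset ℕ) : TF a b →ₗ[ℝ] (s → Matrix (Fin a) (Fin b) ℝ) where
  toFun V i := markov V i
  map_add' U V := funext fun i => markov_add U V i
  map_smul' r V := funext fun i => markov_smul r V i

/-- The weighted inner product of the coefficients with index in `s`. -/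
def weightedForm (S : Matrix (Fin a) (Fin a) ℝ) (T : Matrix (Fin b) (Fin b) ℝ) (s : Finset ℕ) :
    TF a b →ₗ[ℝ] TF a b →ₗ[ℝ] ℝ :=
  LinearMap.mk₂ ℝ
    (fun U V => ∑ i ∈ s, Matrix.trace ((S * markov U i * T)ᵀ * (S * markov V i * T)))
    (fun U U' V => by
      rw [← Finset.sum_add_distrib]
      refine Finset.sum_congr rfl fun i _ => ?_
      rw [markov_add, Matrix.mul_add, Matrix.add_mul, Matrix.transpose_add, Matrix.add_mul,
        Matrix.trace_add])
    (fun r U V => by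
      rw [smul_eq_mul, Finset.mul_sum]
      refine Finset.sum_congr rfl fun i _ => ?_
      rw [markov_smul, Matrix.mul_smul, Matrix.smul_mul, Matrix.transpose_smul, Matrix.smul_mul,
        Matrix.trace_smul, smul_eq_mul])
    (fun U V V' => by
      rw [← Finset.sum_add_distrib]
      refine Finset.sum_congr rfl fun i _ => ?_
      rw [markov_add, Matrix.mul_add, Matrix.add_mul, Matrix.mul_add, Matrix.trace_add])
    (fun r U V => by
      rw [smul_eq_mul, Finset.mul_sum]
      refine Finset.sum_congr rfl fun i _ => ?_
      rw [markov_smul, Matrix.mul_smul, Matrix.smul_mul, Matrix.mul_smul,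
        Matrix.trace_smul, smul_eq_mul])

variable {S : Matrix (Fin a) (Fin a) ℝ} {T : Matrix (Fin b) (Fin b) ℝ} {s : Finset ℕ}

theorem weightedForm_apply (U V : TF a b) : weightedForm S T s U V =
    ∑ i ∈ s, Matrix.trace ((S * markov U i * T)ᵀ * (S * markov V i * T)) := rfl

theorem weightedForm_comm (U V : TF a b) : weightedForm S T s U V = weightedForm S T s V U := by
  rw [weightedForm_apply, weightedForm_apply]
  refine Finset.sum_congr rfl fun i _ => ?_
  rw [← Matrix.trace_transpose, Matrix.transpose_mul, Matrix.transpose_transpose]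

theorem weightedForm_self_nonneg (V : TF a b) : 0 ≤ weightedForm S T s V V :=
  Finset.sum_nonneg fun _ _ => trace_transpose_mul_self_nonneg _

theorem markov_eq_zero_of_mem_firSpace {V : TF a b} (hV : V ∈ firSpace a b s) {t : ℕ}
    (ht : t ∉ s) : markov V t = 0 := by
  obtain ⟨F, rfl⟩ := hV
  rw [markov_fir, if_neg ht]

theorem weightedCost_eq_weightedForm {V : TF a b} (hV : V ∈ firSpace a b s) :
    weightedCost S T V = ENNReal.ofReal (weightedForm S T s V V) := by
  rw [weightedCost_eq_tsum, weightedForm_apply, tsum_eq_sum (s := s),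
    ENNReal.ofReal_sum_of_nonneg fun _ _ => trace_transpose_mul_self_nonneg _]
  intro t ht
  rw [markov_eq_zero_of_mem_firSpace hV ht]
  simp

theorem mem_firSpace_iff_markov {V : TF a b} :
    V ∈ firSpace a b s ↔ VanishesTo 0 V ∧ ∀ t ∉ s, markov V t = 0 := by
  constructor
  · intro h
    refine ⟨?_, fun t ht => markov_eq_zero_of_mem_firSpace h ht⟩
    obtain ⟨F, rfl⟩ := h
    exact vanishesTo_fir s F
  · rintro ⟨h1, h2⟩
    refine ⟨markov V, ext_of_markov h1 (vanishesTo_fir _ _) fun t => ?_⟩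
    rw [markov_fir]
    split_ifs with h
    · rfl
    · exact h2 t h

theorem firSpace_add {U V : TF a b} (hU : U ∈ firSpace a b s) (hV : V ∈ firSpace a b s) :
    U + V ∈ firSpace a b s := by
  rw [mem_firSpace_iff_markov] at *
  exact ⟨hU.1.add hV.1, fun t ht => by rw [markov_add, hU.2 t ht, hV.2 t ht, add_zero]⟩

theorem firSpace_smul (r : ℝ) {V : TF a b} (hV : V ∈ firSpace a b s) :
    r • V ∈ firSpace a b s := by
  rw [mem_firSpace_iff_markov] at *
  refine ⟨fun i j => ?_, fun t ht => by rw [markov_smul, hV.2 t ht, smul_zero]⟩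
  rw [Matrix.smul_apply, RatFunc.smul_eq_C_mul]
  simpa using (degLE_C r).mul (hV.1 i j)

theorem firSpace_sub {U V : TF a b} (hU : U ∈ firSpace a b s) (hV : V ∈ firSpace a b s) :
    U - V ∈ firSpace a b s := by
  rw [mem_firSpace_iff_markov] at *
  exact ⟨hU.1.sub hV.1, fun t ht => by rw [markov_sub, hU.2 t ht, hV.2 t ht, sub_zero]⟩

theorem zero_mem_firSpace : (0 : TF a b) ∈ firSpace a b s :=
  mem_firSpace_iff_markov.mpr ⟨vanishesTo_zero 0, fun t _ => markov_zero t⟩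

theorem isStable_of_mem_firSpace {V : TF a b} (hV : V ∈ firSpace a b s) : IsStable V := by
  obtain ⟨F, rfl⟩ := hV
  exact isStable_fir s F

theorem vanishesTo_one_of_mem_firSpace {N : ℕ} {V : TF a b}
    (hV : V ∈ firSpace a b (Finset.Icc 1 N)) : VanishesTo 1 V := by
  refine vanishesTo_of_markov (k := 1) (isStable_of_mem_firSpace hV).vanishesTo fun t ht => ?_
  refine markov_eq_zero_of_mem_firSpace hV ?_
  rw [Finset.mem_Icc]; omega

theorem vanishesTo_sub_proj {N : ℕ} {V : TF a b} (hV : VanishesTo 1 V) :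
    VanishesTo (N + 1 : ℕ) (V - proj (Finset.Icc 1 N) V) := by
  refine vanishesTo_of_markov ((hV.mono (by norm_num)).sub (vanishesTo_fir _ _)) fun t ht => ?_
  rw [markov_sub, proj, markov_fir]
  by_cases h0 : t = 0
  · rw [if_neg (by simp [h0]), h0, hV.markov_eq_zero (by norm_num), sub_zero]
  · rw [if_pos (by rw [Finset.mem_Icc]; omega), sub_self]

/-- The directions preserving the constraint of the quadratic program. -/
def directionSpace (M1 : TF a a) (M2 : TF b b) (s : Finset ℕ)
    (Yc : ℕ → Submodule ℝ (Matrix (Fin a) (Fin b) ℝ)) : Submodule ℝ (TF a b) where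
  carrier := {V | V ∈ firSpace a b s ∧ ∀ i ∈ s, markov (M1 * V * M2) i ∈ Yc i}
  add_mem' := by
    rintro U V ⟨hU, hU'⟩ ⟨hV, hV'⟩
    refine ⟨firSpace_add hU hV, fun i hi => ?_⟩
    rw [Matrix.mul_add, Matrix.add_mul, markov_add]
    exact (Yc i).add_mem (hU' i hi) (hV' i hi)
  zero_mem' := ⟨zero_mem_firSpace, fun i _ => by
    rw [Matrix.mul_zero, Matrix.zero_mul, markov_zero]; exact (Yc i).zero_mem⟩
  smul_mem' := by
    rintro r V ⟨hV, hV'⟩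
    refine ⟨firSpace_smul r hV, fun i hi => ?_⟩
    rw [Matrix.mul_smul, Matrix.smul_mul, markov_smul]
    exact (Yc i).smul_mem r (hV' i hi)

theorem finiteDimensional_directionSpace (M1 : TF a a) (M2 : TF b b) (s : Finset ℕ)
    (Yc : ℕ → Submodule ℝ (Matrix (Fin a) (Fin b) ℝ)) :
    FiniteDimensional ℝ (directionSpace M1 M2 s Yc) := by
  refine FiniteDimensional.of_injective
    ((markovMap a b s).comp (directionSpace M1 M2 s Yc).subtype) ?_
  rw [injective_iff_map_eq_zero]
  rintro ⟨V, hV⟩ h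
  refine Subtype.ext (eq_zero_of_markov (isStable_of_mem_firSpace hV.1).vanishesTo fun t => ?_)
  by_cases ht : t ∈ s
  · exact congrFun h ⟨t, ht⟩
  · exact markov_eq_zero_of_mem_firSpace hV.1 ht

/-- The quadratic program is feasible and has a solution satisfying the Pythagorean identity. -/
theorem exists_qp_solution {N : ℕ} {M1 : TF a a} {M2 : TF b b} {Z : TF a b}
    (hM1 : IsUnit M1) (hM1' : VanishesTo 0 M1) (hM1i : VanishesTo 0 M1⁻¹) (hM2 : VanishesTo 0 M2)
    (hZ : VanishesTo 1 Z) (hS : IsUnit S) (hT : IsUnit T)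
    (Yc : ℕ → Submodule ℝ (Matrix (Fin a) (Fin b) ℝ)) :
    ∃ V, (V ∈ firSpace a b (Finset.Icc 1 N) ∧
        ∀ i ∈ Finset.Icc 1 N, markov ((Z - M1 * V) * M2) i ∈ Yc i) ∧
      ∀ V', (V' ∈ firSpace a b (Finset.Icc 1 N) ∧
          ∀ i ∈ Finset.Icc 1 N, markov ((Z - M1 * V') * M2) i ∈ Yc i) →
        weightedCost S T V' = weightedCost S T V + weightedCost S T (V' - V) := by
  set s := Finset.Icc 1 N with hs
  set B := weightedForm S T s with hB
  -- The truncation of the unconstrained solution `M1⁻¹ Z` kills the constrained coefficients, so it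
  -- is feasible whatever the subspaces `Yc` are.
  set v := proj s (M1⁻¹ * Z) with hv
  have hvs : v ∈ firSpace a b s := ⟨_, rfl⟩
  have hv0 : ∀ i ∈ s, markov ((Z - M1 * v) * M2) i = 0 := by
    intro i hi
    have h1 := vanishesTo_sub_proj (N := N) (hM1i.proper_mul hZ)
    have h2 : (Z - M1 * v) * M2 = M1 * (M1⁻¹ * Z - v) * M2 := by
      rw [Matrix.mul_sub M1, Matrix.mul_nonsing_inv_cancel_left _ _
        ((Matrix.isUnit_iff_isUnit_det _).mp hM1)]
    rw [h2]
    refine ((hM1'.proper_mul h1).mul_proper hM2).markov_eq_zero ?_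
    rw [hs, Finset.mem_Icc] at hi
    push_cast; omega
  have hfd := finiteDimensional_directionSpace M1 M2 s Yc
  -- Moving `v` within the feasible directions to a point orthogonal to all of them gives the
  -- minimizer.
  obtain ⟨m, hm, hperp⟩ := exists_orthogonal B (directionSpace M1 M2 s Yc) (fun m hm h0 => by
    have h1 : weightedCost S T m = 0 := by
      rw [weightedCost_eq_weightedForm hm.1, ← hB, h0, ENNReal.ofReal_zero]
    exact eq_zero_of_weightedCost_eq_zero hS hT (isStable_of_mem_firSpace hm.1).vanishesTo h1) v
  have hmk : ∀ (U V : TF a b) i, markov ((Z - M1 * (U + V)) * M2) i =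
      markov ((Z - M1 * U) * M2) i - markov (M1 * V * M2) i := by
    intro U V i
    rw [← markov_sub]
    congr 1
    simp only [Matrix.sub_mul, Matrix.mul_add, Matrix.add_mul]
    abel
  have hV : v + m ∈ firSpace a b s := firSpace_add hvs hm.1
  have hV' : ∀ i ∈ s, markov ((Z - M1 * (v + m)) * M2) i ∈ Yc i := by
    intro i hi
    rw [hmk, hv0 i hi, zero_sub]
    exact (Yc i).neg_mem (hm.2 i hi)
  refine ⟨v + m, ⟨hV, hV'⟩, fun V' hF => ?_⟩
  have hd : V' - (v + m) ∈ directionSpace M1 M2 s Yc := by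
    refine ⟨firSpace_sub hF.1 hV, fun i hi => ?_⟩
    have := hmk (v + m) (V' - (v + m)) i
    rw [add_sub_cancel] at this
    have h2 : markov (M1 * (V' - (v + m)) * M2) i = markov ((Z - M1 * (v + m)) * M2) i -
        markov ((Z - M1 * V') * M2) i := by rw [this]; abel
    rw [h2]
    exact (Yc i).sub_mem (hV' i hi) (hF.2 i hi)
  have h0 := hperp _ hd
  rw [weightedCost_eq_weightedForm hF.1, weightedCost_eq_weightedForm hV,
    weightedCost_eq_weightedForm hd.1,
    ← ENNReal.ofReal_add (weightedForm_self_nonneg _) (weightedForm_self_nonneg _), ← hB]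
  congr 1
  conv_lhs => rw [← add_sub_cancel (v + m) V']
  rw [map_add B, LinearMap.add_apply, map_add, map_add (B (V' - (v + m))), h0,
    weightedForm_comm (V' - (v + m)) (v + m), ← hB, h0]
  ring

end QuadraticProgram

/-- `d` is the excess cost of a competitor. Finiteness of `f x` is what permits cancellation in
`ℝ≥0∞`. -/
theorem isUniqueMinimizer_of_add {α : Type*} {f : α → ℝ≥0∞} {s : Set α} {x : α} (hx : x ∈ s)
    (hf : f x ≠ ⊤) (h : ∀ y ∈ s, ∃ d, f y = f x + d ∧ (d = 0 → y = x)) :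
    IsUniqueMinimizer f s x := by
  refine ⟨hx, fun y hy => ?_, fun y hy hmin => ?_⟩
  · obtain ⟨d, hd, -⟩ := h y hy
    change f x ≤ f y
    rw [hd]
    exact le_self_add
  · obtain ⟨d, hd, hd0⟩ := h y hy
    refine hd0 ?_
    have h1 : f y ≤ f x := hmin hx
    rw [hd] at h1
    have h2 : f x + d ≤ f x + 0 := by rwa [add_zero]
    exact le_antisymm ((ENNReal.add_le_add_iff_left hf).mp h2) zero_le

namespace Plant

/-! ### Youla parametrization of the closed loop -/

section Youla

variable {n p1 p2 q1 q2 : ℕ} (P : Plant n p1 p2 q1 q2)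
  (K : Matrix (Fin p2) (Fin n) ℝ) (L : Matrix (Fin n) (Fin q2) ℝ) (Q : TF p2 q2)

/-- The closed-loop map `𝒦 (I - G₂₂ 𝒦)⁻¹` produced by the Youla parameter `Q`. -/
def loopTerm : TF p2 q2 := (P.Yhat K L - P.Mhat K * Q) * P.Mtil L

/-- A one-sided inverse of a square matrix is two-sided, so the block factors also multiply to the
identity in the other order. -/
theorem bezout_backward :
    P.Mhat K * P.Xtil K L - P.Yhat K L * P.Ntil L = 1 ∧
      P.Yhat K L * P.Mtil L = P.Mhat K * P.Ytil K L ∧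
        P.Xhat K L * P.Mtil L - P.Nhat K * P.Ytil K L = 1 := by
  have h := mul_eq_one_comm.mp (P.bezout_blocks K L)
  rw [Matrix.fromBlocks_multiply, ← Matrix.fromBlocks_one, Matrix.fromBlocks_inj] at h
  obtain ⟨h1, h2, -, h4⟩ := h
  refine ⟨?_, ?_, ?_⟩
  · rw [Matrix.mul_neg, ← sub_eq_add_neg] at h1; exact h1
  · rw [Matrix.mul_neg, neg_add_eq_sub, sub_eq_zero] at h2; exact h2
  · rw [Matrix.mul_neg, neg_add_eq_sub] at h4; exact h4

theorem one_add_G22_mul_loopTerm :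
    1 + P.G22 * P.loopTerm K L Q = (P.Xhat K L - P.Nhat K * Q) * P.Mtil L := by
  obtain ⟨-, h2, h3⟩ := P.bezout_backward K L
  rw [loopTerm, Matrix.sub_mul, Matrix.mul_sub, h2, ← Matrix.mul_assoc, G22_mul_Mhat,
    Matrix.sub_mul, Matrix.mul_assoc (P.Mhat K), ← Matrix.mul_assoc P.G22, G22_mul_Mhat, ← h3,
    Matrix.mul_assoc (P.Nhat K)]
  abel

theorem one_add_loopTerm_mul_G22 :
    1 + P.loopTerm K L Q * P.G22 = P.Mhat K * (P.Xtil K L - Q * P.Ntil L) := by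
  obtain ⟨h1, -, -⟩ := P.bezout_backward K L
  rw [loopTerm, Matrix.mul_assoc, Mtil_mul_G22, Matrix.sub_mul, Matrix.mul_sub, ← h1,
    Matrix.mul_assoc]
  abel

theorem loopTerm_eq : P.loopTerm K L Q = P.Mhat K * (P.Ytil K L - Q * P.Mtil L) := by
  obtain ⟨-, h2, -⟩ := P.bezout_backward K L
  rw [loopTerm, Matrix.sub_mul, Matrix.mul_sub, h2, Matrix.mul_assoc]

theorem vanishesTo_G22 : VanishesTo 1 P.G22 := vanishesTo_ss_zero _ _ _

theorem vanishesTo_Yhat : VanishesTo 1 (P.Yhat K L) := vanishesTo_ss_zero _ _ _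

theorem vanishesTo_Mhat : VanishesTo 0 (P.Mhat K) := vanishesTo_ss _ _ _ _

theorem vanishesTo_Mtil : VanishesTo 0 (P.Mtil L) := vanishesTo_ss _ _ _ _

theorem isUnit_Mhat : IsUnit (P.Mhat K) := isUnit_ss_one _ _ _

theorem isUnit_Mtil : IsUnit (P.Mtil L) := isUnit_ss_one _ _ _

variable {Q}

theorem isUnit_Xhat_sub (hQ : VanishesTo 0 Q) : IsUnit (P.Xhat K L - P.Nhat K * Q) := by
  rw [Xhat, ss_eq, const_one, add_sub_right_comm, add_comm]
  exact isUnit_one_add ((vanishesTo_const_res_const _ _ _).sub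
    ((vanishesTo_ss_zero _ _ _).mul_proper hQ))

theorem youla_mul (hQ : VanishesTo 0 Q) :
    P.youla K L Q * (1 + P.G22 * P.loopTerm K L Q) = P.loopTerm K L Q := by
  rw [one_add_G22_mul_loopTerm, youla, ← Matrix.mul_assoc, Matrix.nonsing_inv_mul_cancel_right]
  · rfl
  · exact (Matrix.isUnit_iff_isUnit_det _).mp (P.isUnit_Xhat_sub K L hQ)

theorem loopTerm_eq_youla_add (hQ : VanishesTo 0 Q) :
    P.loopTerm K L Q = P.youla K L Q + P.youla K L Q * P.G22 * P.loopTerm K L Q := by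
  conv_lhs => rw [← P.youla_mul K L hQ]
  rw [Matrix.mul_add, Matrix.mul_one, Matrix.mul_assoc]

theorem one_sub_mul_one_add (hQ : VanishesTo 0 Q) :
    (1 - P.G22 * P.youla K L Q) * (1 + P.G22 * P.loopTerm K L Q) = 1 := by
  rw [Matrix.sub_mul, Matrix.mul_assoc, P.youla_mul K L hQ, Matrix.one_mul, add_sub_cancel_right]

theorem one_sub_youla_mul_one_add (hQ : VanishesTo 0 Q) :
    (1 - P.youla K L Q * P.G22) * (1 + P.loopTerm K L Q * P.G22) = 1 := by
  have h := congrArg (fun Z => Z * P.G22) (P.loopTerm_eq_youla_add K L hQ)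
  simp only [Matrix.add_mul] at h
  rw [Matrix.sub_mul, Matrix.one_mul, Matrix.mul_add, Matrix.mul_one, ← Matrix.mul_assoc]
  nth_rewrite 1 [h]
  abel

theorem inv_one_sub_G22_mul (hQ : VanishesTo 0 Q) :
    (1 - P.G22 * P.youla K L Q)⁻¹ = 1 + P.G22 * P.loopTerm K L Q :=
  Matrix.inv_eq_right_inv (P.one_sub_mul_one_add K L hQ)

theorem inv_one_sub_mul_G22 (hQ : VanishesTo 0 Q) :
    (1 - P.youla K L Q * P.G22)⁻¹ = 1 + P.loopTerm K L Q * P.G22 :=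
  Matrix.inv_eq_right_inv (P.one_sub_youla_mul_one_add K L hQ)

theorem loopTerm_eq_youla_add' (hQ : VanishesTo 0 Q) :
    P.loopTerm K L Q = P.youla K L Q + P.loopTerm K L Q * P.G22 * P.youla K L Q := by
  have h := mul_eq_one_comm.mp (P.one_sub_mul_one_add K L hQ)
  have h2 := congrArg (fun Z => P.youla K L Q * Z) h
  simp only [← Matrix.mul_assoc, P.youla_mul K L hQ, Matrix.mul_one, Matrix.mul_sub] at h2
  exact (sub_eq_iff_eq_add.mp h2)

/-- The controller enters the closed loop only through the loop term, which is affine in `Q`. -/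
theorem closedLoop_youla (hQ : VanishesTo 0 Q) :
    P.closedLoop (P.youla K L Q) = P.P11 K L + P.P12 K * Q * P.P21 L := by
  rw [closedLoop, P.inv_one_sub_G22_mul K L hQ, Matrix.mul_assoc P.G12, P.youla_mul K L hQ,
    loopTerm, P11, P12, P21]
  simp only [Matrix.sub_mul, Matrix.mul_sub, Matrix.neg_mul, Matrix.mul_assoc]
  abel

theorem loopTerm_sub (Q' : TF p2 q2) :
    P.loopTerm K L Q - P.loopTerm K L Q' = -(P.Mhat K * (Q - Q') * P.Mtil L) := by
  simp only [loopTerm, Matrix.sub_mul, Matrix.mul_sub, Matrix.mul_assoc]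
  abel

theorem vanishesTo_loopTerm (hQ : VanishesTo 1 Q) : VanishesTo 1 (P.loopTerm K L Q) :=
  ((P.vanishesTo_Yhat K L).sub ((P.vanishesTo_Mhat K).proper_mul hQ)).mul_proper
    (P.vanishesTo_Mtil L)

theorem vanishesTo_youla (hQ : VanishesTo 1 Q) : VanishesTo 1 (P.youla K L Q) := by
  have hT := P.vanishesTo_loopTerm K L hQ
  have hGT := P.vanishesTo_G22.mul_proper (hT.mono zero_le_one)
  have h2 : P.youla K L Q = P.loopTerm K L Q * (1 + P.G22 * P.loopTerm K L Q)⁻¹ := by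
    conv_rhs => enter [1]; rw [← P.youla_mul K L (hQ.mono zero_le_one)]
    rw [Matrix.mul_nonsing_inv_cancel_right]
    exact (Matrix.isUnit_iff_isUnit_det _).mp (isUnit_one_add hGT)
  rw [h2]
  exact hT.mul_proper (inv_vanishesTo hGT)

/-- Under quadratic invariance the information constraint is affine in the Youla parameter. -/
theorem youla_mem_infoSpace_iff {N : ℕ} {Yc : ℕ → Submodule ℝ (Matrix (Fin p2) (Fin q2) ℝ)}
    (hQI : QuadInvariant (infoSpace N Yc) P.G22) (hQ : VanishesTo 1 Q) :
    P.youla K L Q ∈ infoSpace N Yc ↔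
      ∀ i ∈ Finset.Icc 1 N, markov (P.loopTerm K L Q) i ∈ Yc i := by
  have hT := P.vanishesTo_loopTerm K L hQ
  have h0 := hQ.mono (l := 0) zero_le_one
  have hiff : P.youla K L Q ∈ infoSpace N Yc ↔ P.loopTerm K L Q ∈ infoSpace N Yc := by
    constructor
    · intro h
      exact hQI.mul_inv_mem P.vanishesTo_G22 h (P.loopTerm_eq_youla_add' K L h0)
        (hT.mono zero_le_one)
    · intro h
      -- Recovering the controller from the loop term is again closing a loop, now around `-G₂₂`.
      refine hQI.neg.mul_inv_mem P.vanishesTo_G22.neg h ?_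
        ((P.vanishesTo_youla K L hQ).mono zero_le_one)
      conv_rhs => enter [1]; rw [P.loopTerm_eq_youla_add K L h0]
      rw [Matrix.mul_neg, Matrix.neg_mul, add_neg_cancel_right]
  rw [hiff, mem_infoSpace_iff]
  exact ⟨fun h => h.2, fun h => ⟨hT, h⟩⟩

theorem markov_loopTerm_congr {N i : ℕ} (hi : i ≤ N) {Q' : TF p2 q2}
    (h : VanishesTo (N + 1 : ℕ) (Q - Q')) :
    markov (P.loopTerm K L Q) i = markov (P.loopTerm K L Q') i := by
  rw [← sub_eq_zero, ← markov_sub, loopTerm_sub]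
  refine (((P.vanishesTo_Mhat K).proper_mul h).mul_proper
    (P.vanishesTo_Mtil L)).neg.markov_eq_zero ?_
  push_cast; omega

/-- Every strictly proper controller comes from a strictly proper Youla parameter. -/
theorem exists_youla {Kc : TF p2 q2} (hKc : VanishesTo 1 Kc) :
    ∃ Q, VanishesTo 1 Q ∧ P.youla K L Q = Kc := by
  have hGK : VanishesTo 1 (-(P.G22 * Kc)) :=
    (P.vanishesTo_G22.mul_proper (hKc.mono zero_le_one)).neg
  set D := (1 - P.G22 * Kc)⁻¹ with hD
  have hDu : IsUnit (1 - P.G22 * Kc) := by rw [sub_eq_add_neg]; exact isUnit_one_add hGK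
  have hD0 : VanishesTo 0 D := by rw [hD, sub_eq_add_neg]; exact inv_vanishesTo hGK
  have hdetM := (Matrix.isUnit_iff_isUnit_det _).mp (P.isUnit_Mhat K)
  have hdetT := (Matrix.isUnit_iff_isUnit_det _).mp (P.isUnit_Mtil L)
  have hdetD := (Matrix.isUnit_iff_isUnit_det _).mp hDu
  -- The solution of `loopTerm Q = 𝒦 (I - G₂₂ 𝒦)⁻¹`, which exists because `M̂` and `M̃` are
  -- invertible.
  set Q := (P.Mhat K)⁻¹ * (P.Yhat K L - Kc * D * (P.Mtil L)⁻¹) with hQdef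
  have hQ : VanishesTo 1 Q := (vanishesTo_inv_ss_one _ _ _).proper_mul
    ((P.vanishesTo_Yhat K L).sub ((hKc.mul_proper hD0).mul_proper (vanishesTo_inv_ss_one _ _ _)))
  have hT : P.loopTerm K L Q = Kc * D := by
    rw [loopTerm, hQdef, Matrix.mul_nonsing_inv_cancel_left _ _ hdetM, sub_sub_cancel,
      Matrix.nonsing_inv_mul_cancel_right _ _ hdetT]
  have hDD : 1 + P.G22 * P.loopTerm K L Q = D := by
    have h1 := Matrix.mul_nonsing_inv _ hdetD
    rw [← hD, Matrix.sub_mul, Matrix.one_mul, sub_eq_iff_eq_add] at h1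
    rw [hT, ← Matrix.mul_assoc, ← h1]
  refine ⟨Q, hQ, ?_⟩
  have h1 := P.youla_mul K L (hQ.mono zero_le_one)
  rw [hDD, hT] at h1
  have h2 := congrArg (fun Z => Z * (1 - P.G22 * Kc)) h1
  simpa only [Matrix.mul_assoc, hD, Matrix.nonsing_inv_mul _ hdetD, Matrix.mul_one] using h2

/-- A stable Youla parameter gives an internally stabilizing controller. -/
theorem internallyStabilizes_youla
    (hcop : IsDoublyCoprime P.G22 (P.Mhat K) (P.Nhat K) (P.Xhat K L) (P.Yhat K L)
      (P.Mtil L) (P.Ntil L) (P.Xtil K L) (P.Ytil K L))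
    (h11 : IsStable (P.P11 K L)) (h12 : IsStable (P.P12 K)) (h21 : IsStable (P.P21 L))
    (hQ : IsStable Q) : P.InternallyStabilizes (P.youla K L Q) := by
  have h0 := hQ.vanishesTo
  have hG12M : IsStable (P.G12 * P.Mhat K) := by simpa [P12] using h12.neg
  have hinvK : (1 - P.youla K L Q * P.G22)⁻¹ * P.youla K L Q = P.loopTerm K L Q := by
    rw [P.inv_one_sub_mul_G22 K L h0, Matrix.add_mul, Matrix.one_mul,
      ← P.loopTerm_eq_youla_add' K L h0]
  have hT : IsStable (P.loopTerm K L Q) :=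
    (hcop.stable_Yh.sub (hcop.stable_Mh.mul hQ)).mul hcop.stable_Mt
  have hD := hcop.stable_Xh.sub (hcop.stable_Nh.mul hQ)
  refine ⟨IsUnit.of_mul_eq_one _ (P.one_sub_mul_one_add K L h0),
    IsUnit.of_mul_eq_one _ (P.one_sub_youla_mul_one_add K L h0), ?_, ?_, ?_, ?_, ?_, ?_, ?_, ?_, ?_⟩
  · rw [P.closedLoop_youla K L h0]
    exact h11.add ((h12.mul hQ).mul h21)
  · rw [hinvK, loopTerm, Matrix.mul_assoc]
    exact (hcop.stable_Yh.sub (hcop.stable_Mh.mul hQ)).mul h21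
  · rw [P.inv_one_sub_G22_mul K L h0, one_add_G22_mul_loopTerm, Matrix.mul_assoc]
    exact hD.mul h21
  · rw [P.inv_one_sub_mul_G22 K L h0, one_add_loopTerm_mul_G22, ← Matrix.mul_assoc]
    exact hG12M.mul (hcop.stable_Xt.sub (hQ.mul hcop.stable_Nt))
  · rw [P.inv_one_sub_mul_G22 K L h0, one_add_loopTerm_mul_G22]
    exact hcop.stable_Mh.mul (hcop.stable_Xt.sub (hQ.mul hcop.stable_Nt))
  · rw [P.inv_one_sub_G22_mul K L h0, one_add_G22_mul_loopTerm, Matrix.mul_assoc, Mtil_mul_G22]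
    exact hD.mul hcop.stable_Nt
  · rw [Matrix.mul_assoc, hinvK, loopTerm_eq, ← Matrix.mul_assoc]
    exact hG12M.mul (hcop.stable_Yt.sub (hQ.mul hcop.stable_Mt))
  · rw [hinvK]; exact hT
  · rw [P.inv_one_sub_G22_mul K L h0, one_add_G22_mul_loopTerm]
    exact hD.mul hcop.stable_Mt

end Youla

/-! ### Feasible sets -/

section Feasible

variable {n p1 p2 q1 q2 : ℕ} (P : Plant n p1 p2 q1 q2)
  (K : Matrix (Fin p2) (Fin n) ℝ) (L : Matrix (Fin n) (Fin q2) ℝ) {N : ℕ}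
  {Yc : ℕ → Submodule ℝ (Matrix (Fin p2) (Fin q2) ℝ)}

theorem mem_qpFeasible_iff {V : TF p2 q2} :
    V ∈ P.qpFeasible K L N Yc ↔ V ∈ firSpace p2 q2 (Finset.Icc 1 N) ∧
      ∀ i ∈ Finset.Icc 1 N, markov (P.loopTerm K L V) i ∈ Yc i := by
  refine and_congr_right fun _ => (proj_mem_firPattern_iff subset_rfl).trans ?_
  exact ⟨fun h => h.1, fun h => ⟨h, fun i hi hi' => absurd hi hi'⟩⟩

/-- `M̂` and `M̃` have leading coefficient `I`, and `Ŷ` has none. -/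
theorem markov_loopTerm_zero {V : TF p2 q2} (hV : VanishesTo 0 V) :
    markov (P.loopTerm K L V) 0 = -markov V 0 := by
  have hss : ∀ {n m : ℕ} (A : Matrix (Fin n) (Fin n) ℝ) (B : Matrix (Fin n) (Fin m) ℝ)
      (C : Matrix (Fin m) (Fin n) ℝ), markov (ss A B C 1) 0 = 1 := by
    intro n m A B C
    rw [ss_eq, markov_add, (vanishesTo_const_res_const A B C).markov_eq_zero (by norm_num),
      zero_add, markov_const, if_pos rfl]
  have hM := P.vanishesTo_Mhat K
  have hY := P.vanishesTo_Yhat K L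
  rw [loopTerm, markov_zero_mul ((hY.mono zero_le_one).sub (hM.mul hV)) (P.vanishesTo_Mtil L),
    markov_sub, markov_zero_mul hM hV, hY.markov_eq_zero (by norm_num), Mhat, Mtil, hss, hss]
  simp

/-- The constraint at index 0 forces the constant coefficient of `V` to vanish, so allowing proper
`V` enlarges nothing. -/
theorem mem_mmFeasible_iff {U V : TF p2 q2} :
    (U, V) ∈ P.mmFeasible K L N Yc ↔
      U ∈ delayedStable p2 q2 (N + 1) ∧ V ∈ P.qpFeasible K L N Yc := by
  refine and_congr_right fun _ => ?_
  rw [mem_qpFeasible_iff]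
  have hsub : Finset.Icc 1 N ⊆ Finset.Icc 0 N := Finset.Icc_subset_Icc_left zero_le_one
  have key : proj (Finset.Icc 0 N) ((P.Yhat K L - P.Mhat K * V) * P.Mtil L) ∈ firPattern N Yc ↔
      (∀ i ∈ Finset.Icc 1 N, markov (P.loopTerm K L V) i ∈ Yc i) ∧
        markov (P.loopTerm K L V) 0 = 0 := by
    refine (proj_mem_firPattern_iff hsub).trans (and_congr_right fun _ => ?_)
    constructor
    · intro h
      exact h 0 (by simp) (by simp)
    · intro h i hi hi'
      obtain rfl : i = 0 := by
        rw [Finset.mem_Icc] at hi hi'; omega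
      exact h
  constructor
  · rintro ⟨h1, h2⟩
    obtain ⟨h2, h3⟩ := key.mp h2
    rw [mem_firSpace_iff_markov] at h1
    refine ⟨mem_firSpace_iff_markov.mpr ⟨h1.1, fun t ht => ?_⟩, h2⟩
    by_cases h0 : t = 0
    · rwa [P.markov_loopTerm_zero K L h1.1, neg_eq_zero, ← h0] at h3
    · refine h1.2 t ?_
      rw [Finset.mem_Icc] at ht ⊢; omega
  · rintro ⟨h1, h2⟩
    have hV := mem_firSpace_iff_markov.mp h1
    refine ⟨mem_firSpace_iff_markov.mpr ⟨hV.1, fun t ht => hV.2 t fun h => ht (hsub h)⟩,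
      key.mpr ⟨h2, ?_⟩⟩
    rw [P.markov_loopTerm_zero K L hV.1, hV.2 0 (by simp), neg_zero]

end Feasible

end Plant

end DecH2

end

/-! ### Assembly of the theorem -/

open DecH2 Plant in
theorem theorem3 {n p1 p2 q1 q2 : ℕ} (P : DecH2.Plant n p1 p2 q1 q2) (hP : P.Regular)
    (N : ℕ) (hN : 1 ≤ N)
    (Yc : ℕ → Submodule ℝ (Matrix (Fin p2) (Fin q2) ℝ))
    (hQI : DecH2.QuadInvariant (DecH2.infoSpace N Yc) P.G22)
    (X Y : Matrix (Fin n) (Fin n) ℝ) (hX : P.IsStabilizingX X) (hY : P.IsStabilizingY Y)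
    (K : Matrix (Fin p2) (Fin n) ℝ) (hK : K = P.gainK X)
    (L : Matrix (Fin n) (Fin q2) ℝ) (hL : L = P.gainL Y) :
    -- the gains define a doubly-coprime factorization
    DecH2.IsDoublyCoprime P.G22 (P.Mhat K) (P.Nhat K) (P.Xhat K L) (P.Yhat K L)
      (P.Mtil L) (P.Ntil L) (P.Xtil K L) (P.Ytil K L) ∧
    ∃ V : DecH2.TF p2 q2,
      -- `V` is the unique optimal solution of the quadratic program
      DecH2.IsUniqueMinimizer (P.qpCost X Y) (P.qpFeasible K L N Yc) V ∧
      -- the associated controller is well defined and internally stabilizing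
      IsUnit (P.Xhat K L - P.Nhat K * V) ∧
      P.InternallyStabilizes (P.youla K L V) ∧
      -- it is the optimal solution of the decentralized problem
      DecH2.IsUniqueMinimizer P.cost (DecH2.infoSpace N Yc) (P.youla K L V) ∧
      -- the optimal cost, which is finite
      P.cost (P.youla K L V) = DecH2.h2NormSq (P.P11 K L) + P.qpCost X Y V ∧
      P.cost (P.youla K L V) < ⊤ ∧
      -- the delayed Youla term is optimally zero
      DecH2.IsUniqueMinimizer (fun UV => P.mmCost K L UV.1 UV.2) (P.mmFeasible K L N Yc) (0, V) ∧
      ∀ W ∈ DecH2.firSpace p2 q2 (Finset.Icc 1 N),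
        DecH2.IsUniqueMinimizer (fun U => P.mmCost K L U W)
          (DecH2.delayedStable p2 q2 (N + 1)) 0 := by
  have hXl := hX.lossless hP hK
  have hYl := hY.lossless hP hL
  have hcop := P.isDoublyCoprime K L hXl.schur (isSchur_injection hYl)
  have h11 := isStable_P11 hXl hYl
  have h12 := isStable_P12 hXl
  have h21 := isStable_P21 hYl
  obtain ⟨-, -, hSu⟩ := sqrt_spec hXl.gain_nonneg hX.isUnit
  obtain ⟨-, -, hTu⟩ := sqrt_spec hYl.gain_nonneg hY.isUnit
  refine ⟨hcop, ?_⟩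
  obtain ⟨V, hVf, hV⟩ := exists_qp_solution (N := N) hcop.isUnit_Mh (P.vanishesTo_Mhat K)
    (vanishesTo_inv_ss_one _ _ _) (P.vanishesTo_Mtil L) (P.vanishesTo_Yhat K L) hSu hTu Yc
  have hVq : V ∈ P.qpFeasible K L N Yc := (P.mem_qpFeasible_iff K L).mpr hVf
  replace hV : ∀ V' ∈ P.qpFeasible K L N Yc,
      P.qpCost X Y V' = P.qpCost X Y V + P.qpCost X Y (V' - V) := fun V' hV' =>
    hV V' ((P.mem_qpFeasible_iff K L).mp hV')
  have hVs := isStable_of_mem_firSpace hVf.1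
  have hV1 := vanishesTo_one_of_mem_firSpace hVf.1
  have hfin : ∀ {Q : TF p2 q2}, IsStable Q → P.qpCost X Y Q ≠ ⊤ := fun hQ =>
    (weightedCost_lt_top hQ).ne
  have hdef : ∀ {Q : TF p2 q2}, VanishesTo 0 Q → P.qpCost X Y Q = 0 → Q = 0 := fun hQ h =>
    eq_zero_of_weightedCost_eq_zero hSu hTu hQ h
  have h11fin : h2NormSq (P.P11 K L) ≠ ⊤ := by
    rw [h11.h2NormSq_eq]; exact ENNReal.ofReal_ne_top
  have hcost : ∀ {Q : TF p2 q2}, IsStable Q → VanishesTo 1 Q →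
      h2NormSq (P.P11 K L + P.P12 K * Q * P.P21 L) = h2NormSq (P.P11 K L) + P.qpCost X Y Q :=
    fun hQ hQ1 => h2NormSq_P11_add hXl hYl hX.isUnit hY.isUnit hQ hQ1
  -- `U` lives on indices beyond `N` and `W` on `1, …, N`, so their weighted costs add.
  have hsplit : ∀ {U W : TF p2 q2}, U ∈ delayedStable p2 q2 (N + 1) →
      W ∈ firSpace p2 q2 (Finset.Icc 1 N) →
        P.mmCost K L U W = h2NormSq (P.P11 K L) + (P.qpCost X Y U + P.qpCost X Y W) := by
    intro U W hU hW
    obtain ⟨hUs, hU1⟩ := mem_delayedStable_iff.mp hU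
    have e : P.qpCost X Y (U + W) = P.qpCost X Y U + P.qpCost X Y W := by
      refine weightedCost_add fun t => ?_
      by_cases ht : t ∈ Finset.Icc 1 N
      · left
        refine hU1.markov_eq_zero ?_
        rw [Finset.mem_Icc] at ht
        push_cast; omega
      · exact Or.inr (markov_eq_zero_of_mem_firSpace hW ht)
    rw [← e]
    refine hcost (hUs.add (isStable_of_mem_firSpace hW)) ?_
    exact (hU1.mono (by push_cast; omega)).add (vanishesTo_one_of_mem_firSpace hW)
  have hqp0 : P.qpCost X Y 0 = 0 := weightedCost_zero
  have hzero : (0 : TF p2 q2) ∈ delayedStable p2 q2 (N + 1) :=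
    mem_delayedStable_iff.mpr ⟨isStable_zero, vanishesTo_zero _⟩
  have hcostV : P.cost (P.youla K L V) = h2NormSq (P.P11 K L) + P.qpCost X Y V := by
    rw [cost, P.closedLoop_youla K L hVs.vanishesTo, hcost hVs hV1]
  have hcostV' : P.cost (P.youla K L V) ≠ ⊤ := by
    rw [hcostV]; exact ENNReal.add_ne_top.mpr ⟨h11fin, hfin hVs⟩
  refine ⟨V, ?_, P.isUnit_Xhat_sub K L hVs.vanishesTo,
    P.internallyStabilizes_youla K L hcop h11 h12 h21 hVs, ?_, hcostV, hcostV'.lt_top, ?_, ?_⟩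
  · refine isUniqueMinimizer_of_add hVq (hfin hVs) fun V' hV' => ⟨_, hV V' hV', fun h => ?_⟩
    exact sub_eq_zero.mp (hdef ((isStable_of_mem_firSpace hV'.1).sub hVs).vanishesTo h)
  · refine isUniqueMinimizer_of_add ((P.youla_mem_infoSpace_iff K L hQI hV1).mpr hVf.2) hcostV'
      fun Kc hKc => ?_
    obtain ⟨Q, hQ1, rfl⟩ := P.exists_youla K L (mem_infoSpace_iff.mp hKc).1
    have hQ0 := hQ1.mono (l := 0) zero_le_one
    -- A competitor of infinite cost has excess `⊤`; a finite cost makes the closed loop, hence `Q`,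
    -- stable.
    by_cases htop : P.cost (P.youla K L Q) = ⊤
    · exact ⟨⊤, by rw [htop, add_top], fun h => absurd h ENNReal.top_ne_zero⟩
    have hcl := P.closedLoop_youla K L hQ0
    have hQs : IsStable Q := by
      refine isStable_of_P12_mul_P21 hP (K := K) (L := L) ?_
      have h1 : IsStable (P.P11 K L + P.P12 K * Q * P.P21 L) := by
        refine isStable_of_h2NormSq_ne_top ?_ (by rwa [← hcl])
        exact h11.vanishesTo.add
          ((h12.vanishesTo.mul_proper hQ0).mul_proper h21.vanishesTo)
      simpa using h1.sub h11
    -- `Q` splits into its truncation `W`, which inherits feasibility because the constraint sees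
    -- only the first `N` coefficients, and a delayed stable tail.
    set W := proj (Finset.Icc 1 N) Q with hW
    have hWf : W ∈ firSpace p2 q2 (Finset.Icc 1 N) := ⟨_, rfl⟩
    have hQW := vanishesTo_sub_proj (N := N) hQ1
    have hU : Q - W ∈ delayedStable p2 q2 (N + 1) :=
      mem_delayedStable_iff.mpr ⟨hQs.sub (isStable_of_mem_firSpace hWf), hQW⟩
    have hWq : W ∈ P.qpFeasible K L N Yc := by
      refine (P.mem_qpFeasible_iff K L).mpr ⟨hWf, fun i hi => ?_⟩
      rw [← P.markov_loopTerm_congr K L (Finset.mem_Icc.mp hi).2 hQW]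
      exact (P.youla_mem_infoSpace_iff K L hQI hQ1).mp hKc i hi
    -- The excess is the cost of the tail plus the Pythagorean excess of `W` over `V`; it vanishes
    -- only for `Q = W = V`.
    refine ⟨P.qpCost X Y (Q - W) + P.qpCost X Y (W - V), ?_, fun h => ?_⟩
    · have h1 := hsplit hU hWf
      rw [mmCost, sub_add_cancel, ← hcl] at h1
      rw [cost, h1, hcostV, hV W hWq]
      abel
    · obtain ⟨h1, h2⟩ := add_eq_zero.mp h
      have e1 := hdef (hQs.sub (isStable_of_mem_firSpace hWf)).vanishesTo h1
      have e2 := hdef ((isStable_of_mem_firSpace hWf).sub hVs).vanishesTo h2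
      rw [sub_eq_zero.mp e1, sub_eq_zero.mp e2]
  · have h0V : P.mmCost K L 0 V = h2NormSq (P.P11 K L) + P.qpCost X Y V := by
      rw [hsplit hzero hVf.1, hqp0, zero_add]
    refine isUniqueMinimizer_of_add ((P.mem_mmFeasible_iff K L).mpr ⟨hzero, hVq⟩)
      (by rw [h0V, ← hcostV]; exact hcostV') ?_
    rintro ⟨U, W⟩ hUW
    obtain ⟨hU, hW⟩ := (P.mem_mmFeasible_iff K L).mp hUW
    refine ⟨P.qpCost X Y U + P.qpCost X Y (W - V), ?_, fun h => ?_⟩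
    · simp only
      rw [hsplit hU hW.1, h0V, hV W hW]
      abel
    · obtain ⟨h1, h2⟩ := add_eq_zero.mp h
      rw [hdef (mem_delayedStable_iff.mp hU).1.vanishesTo h1, sub_eq_zero.mp
        (hdef ((isStable_of_mem_firSpace hW.1).sub hVs).vanishesTo h2)]
  · intro W hW
    have h0 : P.mmCost K L 0 W = h2NormSq (P.P11 K L) + P.qpCost X Y W := by
      rw [hsplit hzero hW, hqp0, zero_add]
    refine isUniqueMinimizer_of_add hzero ?_ fun U hU => ⟨P.qpCost X Y U, ?_, fun h => ?_⟩
    · rw [h0]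
      exact ENNReal.add_ne_top.mpr ⟨h11fin, hfin (isStable_of_mem_firSpace hW)⟩
    · rw [hsplit hU hW, h0]
      abel
    · exact hdef (mem_delayedStable_iff.mp hU).1.vanishesTo h
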